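/- Conventions. Graphs are finite and simple. If $G\le\mathrm{Aut}(\Gamma)$ and $v$ is a vertex of $\Gamma$, then $G_v$ is the stabiliser of $v$ in $G$, $\Gamma(v)$ is the neighbourhood of $v$, and $G_v^{\Gamma(v)}\le\mathrm{Sym}(\Gamma(v))$ is the permutation group induced by $G_v$ on $\Gamma(v)$. An arc is an ordered pair $(u,v)$ of adjacent vertices, with stabiliser $G_{uv}=G_u\cap G_v$. For a permutation group $L$, a pair $(\Gamma,G)$ is locally-$L$ if $\Gamma$ is a connected graph, $G\le\mathrm{Aut}(\Gamma)$ is transitive on the vertices of $\Gamma$, and $L$ is permutation isomorphic to $G_v^{\Gamma(v)}$ for a vertex $v$ (the choice of $v$ is irrelevant). For a prime $p$, a transitive permutation group $L$ is $p$-graph-restrictive if there is a constant $c(p,L)$ such that, for every locally-$L$ pair $(\Gamma,G)$ and every arc $(u,v)$ of $\Gamma$, the largest power of $p$ dividing $|G_{uv}|$ is at most $c(p,L)$. Corollary 2.4. Let $p$ be a prime and let $L$ be a transitive permutation group on $\Omega$. Let $x\in\Omega$ and let $P$ be a Sylow $p$-subgroup of the point-stabiliser $L_x$. Suppose that 1.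 $|P|=p$, and 2. there exists $l\in L$ such that $\langle P,P^l\rangle$ is transitive on $\Omega$, where $P^l=l^{-1}Pl$. Then $L$ is $p$-graph-restrictive. In fact, one can take $c(p,L)=p^6$ if $p$ is odd and $c(p,L)=16$ if $p=2$. -/

import Mathlib

universe u v

namespace LocalAction

/-- The permutation of the neighbourhood `Γ(v)` induced by an element of the vertex-stabiliser `G_v`,
as a group homomorphism `G_v → Sym(Γ(v))`. -/
def nbhdPermHom {V : Type v} (Γ : SimpleGraph V) (G : Subgroup (Γ ≃g Γ)) (x : V) :
    MulAction.stabilizer G x →* Equiv.Perm (Γ.neighborSet x) where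
  toFun g := Equiv.subtypeEquiv ((g : G) : Γ ≃g Γ).toEquiv (by
    intro w
    have hx : ((g : G) : Γ ≃g Γ) x = x := g.2
    have h := ((g : G) : Γ ≃g Γ).map_adj_iff (v := x) (w := w)
    rw [hx] at h
    exact h.symm)
  map_one' := by
    ext w
    rfl
  map_mul' a b := by
    ext w
    rfl

/-- The permutation group `G_v^{Γ(v)}` induced by `G_v` on the neighbourhood `Γ(v)`. -/
def localGroup {V : Type v} (Γ : SimpleGraph V) (G : Subgroup (Γ ≃g Γ)) (x : V) :
    Subgroup (Equiv.Perm (Γ.neighborSet x)) :=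
  (nbhdPermHom Γ G x).range

/-- Two permutation groups are permutation isomorphic: some bijection of the underlying sets
carries one onto the other. -/
def PermIsomorphic {Ω : Type u} {Λ : Type v} (L : Subgroup (Equiv.Perm Ω))
    (M : Subgroup (Equiv.Perm Λ)) : Prop :=
  ∃ e : Ω ≃ Λ, L.map e.permCongrHom.toMonoidHom = M

/-- `(Γ, G)` is locally-`L`: the simple graph `Γ` is connected, the group `G` of automorphisms of `Γ`
is transitive on the vertices, and `L` is permutation isomorphic to `G_v^{Γ(v)}` for a vertex `v`
(by vertex-transitivity, the choice of `v` is irrelevant). -/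
structure IsLocally {Ω : Type u} {V : Type v} (Γ : SimpleGraph V) (G : Subgroup (Γ ≃g Γ))
    (L : Subgroup (Equiv.Perm Ω)) : Prop where
  connected : Γ.Connected
  vertexTransitive : MulAction.IsPretransitive G V
  permIsomorphic : ∃ x : V, PermIsomorphic L (localGroup Γ G x)

/-- The arc-stabiliser `G_{uv} = G_u ∩ G_v`. -/
def arcStabilizer {V : Type v} (Γ : SimpleGraph V) (G : Subgroup (Γ ≃g Γ)) (x y : V) :
    Subgroup G :=
  MulAction.stabilizer G x ⊓ MulAction.stabilizer G y

/-- `c` can be taken as the constant `c(p, L)`: for every locally-`L` pair `(Γ, G)` with `Γ` finite,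
the largest power of `p` dividing the order of an arc-stabiliser is at most `c`. -/
def PGraphRestrictiveBound {Ω : Type u} (p : ℕ) (L : Subgroup (Equiv.Perm Ω)) (c : ℕ) : Prop :=
  ∀ (V : Type v) [Finite V] (Γ : SimpleGraph V) (G : Subgroup (Γ ≃g Γ)), IsLocally Γ G L →
    ∀ x y : V, Γ.Adj x y → p ^ (Nat.card (arcStabilizer Γ G x y)).factorization p ≤ c

/-- The transitive permutation group `L` is `p`-graph-restrictive. -/
def IsPGraphRestrictive {Ω : Type u} (p : ℕ) (L : Subgroup (Equiv.Perm Ω)) : Prop :=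
  MulAction.IsPretransitive L Ω ∧ ∃ c : ℕ, PGraphRestrictiveBound.{u, v} p L c

/-- A Sylow `p`-subgroup of the point-stabiliser `L_x`, regarded as a subgroup of `L`. -/
def sylowInGroup {Ω : Type u} {p : ℕ} (L : Subgroup (Equiv.Perm Ω)) (x : Ω)
    (P : Sylow p (MulAction.stabilizer L x)) : Subgroup L :=
  (P : Subgroup (MulAction.stabilizer L x)).map (MulAction.stabilizer L x).subtype

/-- The conjugate `P^l = l⁻¹ P l`. -/
def conjBy {H : Type u} [Group H] (P : Subgroup H) (l : H) : Subgroup H :=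
  P.map (MulAut.conj l⁻¹).toMonoidHom

end LocalAction

open scoped Pointwise commutatorElement

/-! ### Subgroups of prime order or prime index -/

namespace Subgroup

variable {G : Type*} [Group G]

/-! Let (v,u) be an arc, B its stabiliser, K the kernel of G_v on Γ(v) and S a Sylow p-subgroup of
B; the aim is to bound |S|. The hypothesis |P| = p gives |S : S ∩ K| = p, and transitivity of ⟨P,
P^l⟩ gives G_v = HB with H = ⟨S, lSl⁻¹⟩. After Sylow adjustments, S ∩ lSl⁻¹ = S ∩ K, l ∈ H, and some
t reversing the arc normalises S. A subgroup of S ∩ K normalised by H and t is trivial, because its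
normaliser is vertex-transitive while it fixes v. `IsPushingAmalgam` records what is kept of the
graph.

Put g = lt and S_i = g^i S g^(-i) (`conjSeq`), so S_0 = S and S_1 = lSl⁻¹. Write Q_i = S_i ∩
S_(i+1), Z_i for the centre of S_i (`conjCenter`), V_i for the centre of Q_i (`conjInfCenter`), and
S_i..S_j for the intersection of a run of conjugates; `conjInf g S n i` is S_i..S_(i+n). Each
further conjugate costs index at most p, and a subgroup containing g and a nontrivial S_0..S_n
contains S (`le_of_conjInf_le`).

If Z_0 is not in Q_0, then S_(-1)..S_1 is trivial and |S| ≤ p². Otherwise there is a critical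
distance b (`exists_isCritical`): V_i lies in S_(i-b+1)..S_(i+b) but in neither adjacent conjugate,
and V_i does not commute with V_(i+b). Then S induces on V_0 a transvection group of order p with
fixed subgroup Z_0. The crux, `conj_mem_centralizer_of_transvections`, is that t² normalises
C_(V_0)(H) = Z_0 ∩ Z_1. Hence t interchanges Z_(-1) ∩ Z_0 with Z_0 ∩ Z_1, so three consecutive
centres meet trivially (`conjCenter_inf_eq`); this yields |Z_0| ≤ p² and b ≤ 2.

Finally S_(-b)..S_b is abelian and even lies in Z_0, so |S| ≤ p^(2b) · p² ≤ p^6. For p = 2 an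
argument with groups of exponent 2 excludes b = 2 (`not_isCritical_two`), which leaves 2^4. -/

theorem card_mul_relIndex {K A : Subgroup G} (h : K ≤ A) :
    Nat.card K * K.relIndex A = Nat.card A := by
  rw [← relIndex_bot_left, ← relIndex_bot_left, relIndex_mul_relIndex _ _ _ bot_le h]

theorem eq_or_eq_of_relIndex_prime {K J A : Subgroup G} (hKJ : K ≤ J) (hJA : J ≤ A)
    (h : (K.relIndex A).Prime) : J = K ∨ J = A := by
  have h1 := relIndex_mul_relIndex _ _ _ hKJ hJA
  rcases (Nat.dvd_prime h).1 ⟨_, h1.symm⟩ with h2 | h2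
  · exact Or.inl (le_antisymm (relIndex_eq_one.1 h2) hKJ)
  · right
    rw [h2] at h1
    exact le_antisymm hJA (relIndex_eq_one.1 ((Nat.mul_eq_left h.ne_zero).1 h1))

theorem sup_eq_of_relIndex_prime {K J A : Subgroup G} (hK : K ≤ A) (hJ : J ≤ A)
    (hn : ¬ J ≤ K) (h : (K.relIndex A).Prime) : K ⊔ J = A :=
  (eq_or_eq_of_relIndex_prime le_sup_left (sup_le hK hJ) h).resolve_left
    fun e => hn (le_sup_right.trans e.le)

theorem inf_eq_bot_of_card_prime {K J : Subgroup G} (h : (Nat.card K).Prime) (hn : ¬ K ≤ J) :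
    K ⊓ J = ⊥ :=
  (eq_or_eq_of_relIndex_prime bot_le inf_le_left (by rwa [relIndex_bot_left])).resolve_right
    fun e => hn (inf_eq_left.1 e)

theorem eq_of_mem_of_card_prime {K J : Subgroup G} (h : (Nat.card K).Prime) {a : G}
    (ha : a ∈ K) (hJ : a ∈ J) (h1 : a ≠ 1) : K ≤ J := by
  by_contra hn
  have : a ∈ K ⊓ J := ⟨ha, hJ⟩
  rw [inf_eq_bot_of_card_prime h hn] at this
  exact h1 (mem_bot.1 this)

theorem exists_zpow_eq_of_card_prime {K : Subgroup G} (h : (Nat.card K).Prime) {a b : G}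
    (ha : a ∈ K) (h1 : a ≠ 1) (hb : b ∈ K) : ∃ i : ℤ, a ^ i = b :=
  mem_zpowers_iff.1 (eq_of_mem_of_card_prime h ha (mem_zpowers a) h1 hb)

theorem exists_ne_one_of_card_prime {K : Subgroup G} (h : (Nat.card K).Prime) :
    ∃ a ∈ K, a ≠ 1 := by
  by_contra! hn
  have : K = ⊥ := (eq_bot_iff_forall _).2 hn
  rw [this] at h
  simp [Nat.not_prime_one] at h

theorem mul_inv_zpow_mem_of_index_prime {G : Type*} [CommGroup G] {K : Subgroup G}
    (h : K.index.Prime) {a : G} (ha : a ∉ K) (b : G) : ∃ i : ℤ, b * a ^ i ∈ K := by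
  have : b ∈ K ⊔ zpowers a := by
    rw [sup_eq_of_relIndex_prime (A := ⊤) le_top le_top (by simpa using ha)
      (by rwa [relIndex_top_right])]
    trivial
  obtain ⟨k, hk, z, hz, rfl⟩ := mem_sup.1 this
  obtain ⟨i, rfl⟩ := mem_zpowers_iff.1 hz
  exact ⟨-i, by simpa using hk⟩

theorem relIndex_eq_prime_of_le {p : ℕ} [hp : Fact p.Prime] {K A : Subgroup G} [Finite A]
    (hA : IsPGroup p A) (h : K.relIndex A ≤ p) (hn : ¬ A ≤ K) : K.relIndex A = p := by
  obtain ⟨n, hn'⟩ := hA.index (K.subgroupOf A)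
  change K.relIndex A = p ^ n at hn'
  rw [hn'] at h ⊢
  have h1 : n ≤ 1 := by
    by_contra! h1
    exact absurd (Nat.pow_lt_pow_right hp.out.one_lt h1) (by rw [pow_one]; omega)
  interval_cases n
  · rw [pow_zero, relIndex_eq_one] at hn'
    exact absurd hn' hn
  · exact pow_one p

theorem relIndex_eq_prime_of_index_eq {p : ℕ} [hp : Fact p.Prime] [Finite G] (hG : IsPGroup p G)
    {K A : Subgroup G} (hK : K.index = p) (hA : A.index = p) (hn : K ≠ A) : K.relIndex A = p := by
  refine relIndex_eq_prime_of_le (hG.to_subgroup A) ?_ fun h => hn ?_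
  · rw [← hK, ← relIndex_top_right]
    exact relIndex_le_of_le_right le_top
      (by rw [relIndex_top_right, hK]; exact hp.out.ne_zero)
  · have h1 := relIndex_mul_index h
    rw [hK, hA] at h1
    exact le_antisymm (relIndex_eq_one.1 ((Nat.mul_eq_right hp.out.ne_zero).1 h1)) h

/-- If `G = HB` as a product of sets, then `|G : B| = |H : H ∩ B|`. -/
theorem relIndex_eq_index_of_factor {H B : Subgroup G}
    (h : ∀ g : G, ∃ x ∈ H, ∃ b ∈ B, g = x * b) : B.relIndex H = B.index := by
  have : MulAction.IsPretransitive H (G ⧸ B) := by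
    have key : ∀ q : G ⧸ B, ∃ x : H, x • ((1 : G) : G ⧸ B) = q := by
      intro q
      obtain ⟨g, rfl⟩ := QuotientGroup.mk_surjective q
      obtain ⟨x, hx, b, hb, rfl⟩ := h g
      refine ⟨⟨x, hx⟩, ?_⟩
      change ((x * 1 : G) : G ⧸ B) = _
      rw [QuotientGroup.eq]
      simpa using hb
    refine ⟨fun q r => ?_⟩
    obtain ⟨x, rfl⟩ := key q
    obtain ⟨y, rfl⟩ := key r
    exact ⟨y * x⁻¹, by rw [mul_smul, inv_smul_smul]⟩
  have h1 := MulAction.index_stabilizer_of_transitive H ((1 : G) : G ⧸ B)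
  rw [index, ← h1, relIndex]
  congr 1
  ext x
  rw [mem_subgroupOf, MulAction.mem_stabilizer_iff]
  change _ ↔ (((x : G) * 1 : G) : G ⧸ B) = _
  rw [eq_comm, QuotientGroup.eq]
  simp

end Subgroup

/-! ### Groups of transvections on an abelian p-group -/

section Transvection

variable {E V : Type*} [Group E] [CommGroup V] [MulDistribMulAction E V]

/-- The displacement `v ↦ (x • v) v⁻¹` of a group element acting on an abelian group. -/
def displacement (V : Type*) [CommGroup V] [MulDistribMulAction E V] (x : E) : V →* V where
  toFun v := x • v * v⁻¹
  map_one' := by simp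
  map_mul' a b := by simp [mul_mul_mul_comm, mul_comm]

/-- The subgroup of vectors fixed by all elements of `T`. -/
def fixedSubgroup (V : Type*) [CommGroup V] [MulDistribMulAction E V] (T : Subgroup E) :
    Subgroup V where
  carrier := {v | ∀ x ∈ T, x • v = v}
  one_mem' x _ := smul_one x
  mul_mem' ha hb x hx := by rw [smul_mul', ha x hx, hb x hx]
  inv_mem' ha x hx := by rw [smul_inv', ha x hx]

/-- The subgroup `[V, T]` generated by the displacements of elements of `T`. -/
def displacementSubgroup (V : Type*) [CommGroup V] [MulDistribMulAction E V] (T : Subgroup E) :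
    Subgroup V :=
  ⨆ x : T, (displacement V (x : E)).range

theorem displacement_apply (x : E) (v : V) : displacement V x v = x • v * v⁻¹ := rfl

theorem smul_eq_displacement_mul (x : E) (v : V) : x • v = displacement V x v * v := by
  simp [displacement_apply]

theorem mem_fixedSubgroup {T : Subgroup E} {v : V} :
    v ∈ fixedSubgroup V T ↔ ∀ x ∈ T, x • v = v := Iff.rfl

theorem displacement_mem {T : Subgroup E} {x : E} (hx : x ∈ T) (v : V) :
    displacement V x v ∈ displacementSubgroup V T :=
  (le_iSup (fun x : T => (displacement V (x : E)).range) ⟨x, hx⟩) ⟨v, rfl⟩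

theorem displacementSubgroup_le {T : Subgroup E} {K : Subgroup V}
    (h : ∀ x ∈ T, ∀ v, displacement V x v ∈ K) : displacementSubgroup V T ≤ K := by
  refine iSup_le fun x => ?_
  rintro _ ⟨v, rfl⟩
  exact h x x.2 v

theorem displacement_conj (e x : E) (v : V) :
    displacement V (e * x * e⁻¹) (e • v) = e • displacement V x v := by
  simp [displacement_apply, mul_smul]

theorem mem_conj_smul {T : Subgroup E} {e x : E} :
    x ∈ MulAut.conj e • T ↔ e⁻¹ * x * e ∈ T := by
  rw [Subgroup.mem_pointwise_smul_iff_inv_smul_mem, ← map_inv]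
  simp

theorem conj_mem_conj_smul {T : Subgroup E} {e x : E} (hx : x ∈ T) :
    e * x * e⁻¹ ∈ MulAut.conj e • T := by
  rw [mem_conj_smul]; simpa [mul_assoc] using hx

theorem mem_fixedSubgroup_conj {T : Subgroup E} {e : E} {v : V} :
    v ∈ fixedSubgroup V (MulAut.conj e • T) ↔ e⁻¹ • v ∈ fixedSubgroup V T := by
  simp only [mem_fixedSubgroup]
  constructor
  · intro h x hx
    have := h _ (conj_mem_conj_smul (e := e) hx)
    rw [mul_smul, mul_smul] at this
    exact eq_inv_smul_iff.2 this
  · intro h x hx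
    have := h _ (mem_conj_smul.1 hx)
    simp only [mul_smul, smul_inv_smul] at this
    exact (smul_left_cancel _ this)

theorem fixedSubgroup_sup (S T : Subgroup E) :
    fixedSubgroup V (S ⊔ T) = fixedSubgroup V S ⊓ fixedSubgroup V T := by
  ext v
  constructor
  · exact fun h => ⟨fun x hx => h x (Subgroup.mem_sup_left hx),
      fun x hx => h x (Subgroup.mem_sup_right hx)⟩
  · rintro ⟨h1, h2⟩
    have : S ⊔ T ≤ MulAction.stabilizer E v := sup_le h1 h2
    exact fun x hx => this hx

theorem fixedSubgroup_conj {T : Subgroup E} {e : E} :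
    fixedSubgroup V (MulAut.conj e • T) = e • fixedSubgroup V T := by
  ext v
  rw [mem_fixedSubgroup_conj, Subgroup.mem_pointwise_smul_iff_inv_smul_mem]

theorem le_stabilizer_of_displacementSubgroup_le {T : Subgroup E} {N : Subgroup V}
    (h : displacementSubgroup V T ≤ N) : T ≤ MulAction.stabilizer E N := by
  have key : ∀ x ∈ T, x • N ≤ N := by
    rintro x hx _ ⟨v, hv, rfl⟩
    change x • v ∈ N
    rw [smul_eq_displacement_mul]
    exact mul_mem (h (displacement_mem hx v)) hv
  intro x hx
  refine le_antisymm (key x hx) ?_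
  rw [Subgroup.subset_pointwise_smul_iff]
  exact key _ (inv_mem hx)

theorem smul_displacementSubgroup_le {T : Subgroup E} {e : E} {v : V}
    (hv : v ∈ displacementSubgroup V T) :
    e • v ∈ displacementSubgroup V (MulAut.conj e • T) := by
  have : displacementSubgroup V T ≤ (displacementSubgroup V (MulAut.conj e • T)).comap
      (MulDistribMulAction.toMonoidHom V e) := by
    refine displacementSubgroup_le fun x hx v => ?_
    simp only [Subgroup.mem_comap, MulDistribMulAction.toMonoidHom_apply]
    rw [← displacement_conj]
    exact displacement_mem (conj_mem_conj_smul hx) _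
  exact this hv

/-- The stabiliser of the chain `V ≥ N ≥ K ≥ 1`. -/
def chainStabilizer (N K : Subgroup V) : Subgroup E where
  carrier := {x | (∀ v, displacement V x v ∈ N) ∧ (∀ v ∈ N, displacement V x v ∈ K) ∧
    ∀ v ∈ K, x • v = v}
  one_mem' := by simp [displacement_apply, one_mem]
  mul_mem' {x y} hx hy := by
    have key : ∀ v : V, displacement V (x * y) v =
        displacement V x (displacement V y v) * displacement V x v * displacement V y v := by
      intro v
      rw [displacement_apply, mul_smul, smul_eq_displacement_mul y v, smul_mul',
        smul_eq_displacement_mul x v, smul_eq_displacement_mul x (displacement V y v)]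
      simp only [mul_comm, mul_left_comm, mul_inv_cancel_left]
    refine ⟨fun v => ?_, fun v hv => ?_, fun v hv => ?_⟩
    · rw [key]; exact mul_mem (mul_mem (hx.1 _) (hx.1 _)) (hy.1 _)
    · rw [key]
      exact mul_mem (mul_mem (hx.2.1 _ (hy.1 _)) (hx.2.1 _ hv)) (hy.2.1 _ hv)
    · rw [mul_smul, hy.2.2 v hv, hx.2.2 v hv]
  inv_mem' {x} hx := by
    have key : ∀ v : V, displacement V x⁻¹ v = (displacement V x (x⁻¹ • v))⁻¹ := by
      intro v; simp [displacement_apply]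
    have h1 : ∀ v, displacement V x⁻¹ v ∈ N := fun v => by
      rw [key]; exact inv_mem (hx.1 _)
    refine ⟨h1, fun v hv => ?_, fun v hv => ?_⟩
    · rw [key]
      refine inv_mem (hx.2.1 _ ?_)
      rw [smul_eq_displacement_mul]
      exact mul_mem (h1 v) hv
    · rw [inv_smul_eq_iff, hx.2.2 v hv]

theorem pow_smul_of_smul_eq {x : E} {v z : V} (h : x • v = z * v) (hz : x • z = z) (n : ℕ) :
    x ^ n • v = z ^ n * v := by
  induction n with
  | zero => simp
  | succ n ih => rw [pow_succ', mul_smul, ih, smul_mul', smul_pow', hz, h, pow_succ, mul_assoc]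

/-- With p^k = |V|, an element x moves each vector of N by a vector that it fixes, so x^(p^k) is
trivial on N. The same argument applied to x^(p^k) on V shows that its p^k-th power is trivial. -/
theorem isPGroup_chainStabilizer {p : ℕ} [Fact p.Prime] [Finite V] [FaithfulSMul E V]
    (hV : IsPGroup p V)
    (N K : Subgroup V) : IsPGroup p (chainStabilizer (E := E) N K) := by
  obtain ⟨k, hk⟩ := IsPGroup.iff_card.1 hV
  rintro ⟨x, hx⟩
  refine ⟨k + k, ?_⟩
  ext1
  simp only [SubmonoidClass.mk_pow, OneMemClass.coe_one]
  have h1 : ∀ z : V, z ^ p ^ k = 1 := fun z => by rw [← hk]; exact pow_card_eq_one'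
  have h2 : ∀ v ∈ N, x ^ p ^ k • v = v := fun v hv => by
    rw [pow_smul_of_smul_eq (smul_eq_displacement_mul x v) (hx.2.2 _ (hx.2.1 _ hv)), h1, one_mul]
  refine eq_of_smul_eq_smul (α := V) fun v => ?_
  rw [pow_add, pow_mul, pow_smul_of_smul_eq (smul_eq_displacement_mul (x ^ p ^ k) v)
    (h2 _ ((pow_mem hx (p ^ k)).1 v)), h1, one_mul, one_smul]

/-- A group of order `p` acting on `V` as a group of transvections. -/
structure IsTransvectionGroup (p : ℕ) (V : Type*) [CommGroup V] [MulDistribMulAction E V]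
    (T : Subgroup E) : Prop where
  card_eq : Nat.card T = p
  index_eq : (fixedSubgroup V T).index = p
  displacement_mem : ∀ x ∈ T, ∀ v : V, displacement V x v ∈ fixedSubgroup V T

namespace IsTransvectionGroup

variable {p : ℕ} {T : Subgroup E}

theorem conj (hT : IsTransvectionGroup p V T) (e : E) :
    IsTransvectionGroup p V (MulAut.conj e • T) where
  card_eq := by rw [Nat.card_congr (Subgroup.equivSMul (MulAut.conj e) T).toEquiv.symm, hT.card_eq]
  index_eq := by
    have : fixedSubgroup V (MulAut.conj e • T) = (fixedSubgroup V T).comap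
        (MulDistribMulAction.toMulEquiv V e⁻¹ : V →* V) := by
      ext v
      exact mem_fixedSubgroup_conj
    rw [this, Subgroup.index_comap_of_surjective _ (MulEquiv.surjective _), hT.index_eq]
  displacement_mem x hx v := by
    have := hT.displacement_mem _ (mem_conj_smul.1 hx) (e⁻¹ • v)
    rw [mem_fixedSubgroup_conj]
    convert this using 1
    rw [← displacement_conj]
    simp [mul_assoc]

theorem displacementSubgroup_le_fixedSubgroup (hT : IsTransvectionGroup p V T) :
    displacementSubgroup V T ≤ fixedSubgroup V T :=
  displacementSubgroup_le hT.displacement_mem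

theorem displacement_pow (hT : IsTransvectionGroup p V T) {x : E} (hx : x ∈ T) (n : ℕ) (v : V) :
    displacement V (x ^ n) v = displacement V x v ^ n := by
  rw [displacement_apply, pow_smul_of_smul_eq (smul_eq_displacement_mul x v)
    (hT.displacement_mem x hx v x hx), mul_inv_cancel_right]

/-- Two conjugate transvection groups with different fixed subgroups, which are conjugate in the
group that they generate: neither centre is fixed by the other group. -/
theorem not_displacementSubgroup_le (hT : IsTransvectionGroup p V T) {l : E}
    (hl : l ∈ T ⊔ MulAut.conj l • T)
    (hne : fixedSubgroup V (MulAut.conj l • T) ≠ fixedSubgroup V T) :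
    ¬ displacementSubgroup V (MulAut.conj l • T) ≤ fixedSubgroup V T := by
  intro hle
  refine hne ?_
  -- Both groups preserve C_V(T), since they move vectors by elements of it. So l preserves it,
  -- while l carries C_V(T) to C_V(lTl⁻¹).
  rw [fixedSubgroup_conj]
  exact sup_le (le_stabilizer_of_displacementSubgroup_le
    hT.displacementSubgroup_le_fixedSubgroup) (le_stabilizer_of_displacementSubgroup_le hle) hl

theorem not_displacementSubgroup_le' (hT : IsTransvectionGroup p V T) {l : E}
    (hl : l ∈ T ⊔ MulAut.conj l • T)
    (hne : fixedSubgroup V (MulAut.conj l • T) ≠ fixedSubgroup V T) :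
    ¬ displacementSubgroup V T ≤ fixedSubgroup V (MulAut.conj l • T) := by
  have h : MulAut.conj l⁻¹ • MulAut.conj l • T = T := by rw [map_inv, inv_smul_smul]
  have := (hT.conj l).not_displacementSubgroup_le (l := l⁻¹)
    (by rw [h, sup_comm]; exact inv_mem hl) (by rw [h]; exact hne.symm)
  rwa [h] at this

theorem exists_ne_one [hp : Fact p.Prime] (hT : IsTransvectionGroup p V T) : ∃ x ∈ T, x ≠ 1 :=
  Subgroup.exists_ne_one_of_card_prime (by rw [hT.card_eq]; exact hp.out)

variable [hp : Fact p.Prime] [Finite E]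

theorem exists_pow_eq (hT : IsTransvectionGroup p V T) {x y : E} (hx : x ∈ T) (hx1 : x ≠ 1)
    (hy : y ∈ T) : ∃ n : ℕ, x ^ n = y := by
  have h1 : T ≤ Subgroup.zpowers x := Subgroup.eq_of_mem_of_card_prime
    (by rw [hT.card_eq]; exact hp.out) hx (Subgroup.mem_zpowers x) hx1
  exact mem_powers_iff_mem_zpowers.2 (h1 hy)

theorem displacementSubgroup_eq_range (hT : IsTransvectionGroup p V T) {x : E} (hx : x ∈ T)
    (hx1 : x ≠ 1) : displacementSubgroup V T = (displacement V x).range := by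
  refine le_antisymm (displacementSubgroup_le fun y hy v => ?_) ?_
  · obtain ⟨n, rfl⟩ := hT.exists_pow_eq hx hx1 hy
    rw [hT.displacement_pow hx]
    exact pow_mem (MonoidHom.mem_range.2 ⟨v, rfl⟩) n
  · rintro _ ⟨v, rfl⟩
    exact _root_.displacement_mem hx v

theorem fixed_of_smul_eq (hT : IsTransvectionGroup p V T) {x : E} (hx : x ∈ T) (hx1 : x ≠ 1)
    {v : V} (h : x • v = v) : v ∈ fixedSubgroup V T := by
  intro y hy
  obtain ⟨n, rfl⟩ := hT.exists_pow_eq hx hx1 hy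
  rw [pow_smul_of_smul_eq (z := 1) (by simpa using h) (by simp)]
  simp

/-- For 1 ≠ x ∈ T the displacement of x has image [V,T] and kernel C_V(T), of index p. -/
theorem card_displacementSubgroup (hT : IsTransvectionGroup p V T) :
    Nat.card (displacementSubgroup V T) = p := by
  obtain ⟨x, hx, hx1⟩ := hT.exists_ne_one
  rw [hT.displacementSubgroup_eq_range hx hx1, ← Subgroup.index_ker, ← hT.index_eq]
  congr 1
  ext v
  rw [MonoidHom.mem_ker, displacement_apply, mul_inv_eq_one]
  exact ⟨hT.fixed_of_smul_eq hx hx1, fun h => h x hx⟩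

/-- T and D both stabilise the chain V ≥ C_V(T) ≥ C_V(T) ∩ C_V(D) ≥ 1. The chain stabiliser is a
p-group, so it has order at most p and equals both. -/
theorem eq_of_displacementSubgroup_le [Finite V] [FaithfulSMul E V]
    (hV : IsPGroup p V) {D : Subgroup E} (hT : IsTransvectionGroup p V T)
    (hD : IsTransvectionGroup p V D) (hE : ¬ p ^ 2 ∣ Nat.card E)
    (h : displacementSubgroup V D ≤ fixedSubgroup V T) : D = T := by
  set X := chainStabilizer (E := E) (fixedSubgroup V T) (fixedSubgroup V T ⊓ fixedSubgroup V D)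
    with hX
  have hTX : T ≤ X := fun x hx => ⟨hT.displacement_mem x hx, fun v hv => by
    rw [displacement_apply, hv x hx, mul_inv_cancel]; exact one_mem _, fun v hv => hv.1 x hx⟩
  have hDX : D ≤ X := fun x hx => ⟨fun v => h (_root_.displacement_mem hx v),
    fun v _ => ⟨h (_root_.displacement_mem hx v), hD.displacement_mem x hx v⟩,
    fun v hv => hv.2 x hx⟩
  obtain ⟨k, hk⟩ := IsPGroup.iff_card.1 (isPGroup_chainStabilizer (E := E) hV (fixedSubgroup V T)
    (fixedSubgroup V T ⊓ fixedSubgroup V D))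
  have hk1 : k ≤ 1 := by
    by_contra! hk1
    exact hE (((pow_dvd_pow p hk1).trans hk.symm.dvd).trans (Subgroup.card_subgroup_dvd_card X))
  have hXp : Nat.card X ≤ p := by
    rw [hk]; exact (Nat.pow_le_pow_right hp.out.pos hk1).trans (pow_one p).le
  rw [Subgroup.eq_of_le_of_card_ge hDX (by rwa [hD.card_eq]),
    Subgroup.eq_of_le_of_card_ge hTX (by rwa [hT.card_eq])]

/-- A p-subgroup P of H = ⟨T, T₁⟩ containing T fixes a nontrivial vector of W = [V,T][V,T₁], which
must lie in [V,T]. Hence P fixes all of C_V(T), and therefore acts faithfully on the images of a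
single vector of W, a group of order at most p². -/
theorem not_sq_dvd_card_sup [Finite V] [FaithfulSMul E V] (hV : IsPGroup p V)
    (hT : IsTransvectionGroup p V T) {l : E}
    (hl : l ∈ T ⊔ MulAut.conj l • T)
    (hne : fixedSubgroup V (MulAut.conj l • T) ≠ fixedSubgroup V T) :
    ¬ p ^ 2 ∣ Nat.card (T ⊔ MulAut.conj l • T : Subgroup E) := by
  intro hdvd
  set T₁ := MulAut.conj l • T with hT₁
  set H := T ⊔ T₁ with hH
  have h1 := hT.not_displacementSubgroup_le hl hne
  have h2 := hT.not_displacementSubgroup_le' hl hne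
  have hc : (Nat.card (displacementSubgroup V T)).Prime := by
    rw [hT.card_displacementSubgroup]; exact hp.out
  have hc₁ : (Nat.card (displacementSubgroup V T₁)).Prime := by
    rw [(hT.conj l).card_displacementSubgroup]; exact hp.out
  obtain ⟨P, hP, hTP⟩ : ∃ P : Subgroup E, IsPGroup p P ∧ T ≤ P ∧ P ≤ H ∧ p ^ 2 ∣ Nat.card P := by
    obtain ⟨Q, hQ⟩ := ((IsPGroup.of_card (n := 1) (by rw [hT.card_eq, pow_one]) :
      IsPGroup p T).comap_subtype (K := H)).exists_le_sylow
    refine ⟨Q.map H.subtype, Q.isPGroup'.map _, ?_, ?_, ?_⟩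
    · intro x hx
      exact ⟨⟨x, le_sup_left (a := T) hx⟩, hQ hx, rfl⟩
    · exact Subgroup.map_subtype_le _
    · rw [Subgroup.card_subtype]
      exact Q.pow_dvd_card_of_pow_dvd_card hdvd
  obtain ⟨hTP, hPH, hPc⟩ := hTP
  set W := displacementSubgroup V T ⊔ displacementSubgroup V T₁ with hW
  have hWstab : H ≤ MulAction.stabilizer E W :=
    sup_le (le_stabilizer_of_displacementSubgroup_le le_sup_left)
      (le_stabilizer_of_displacementSubgroup_le le_sup_right)
  have hWmem : ∀ x ∈ P, ∀ w ∈ W, x • w ∈ W := fun x hx w hw => by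
    have := Subgroup.smul_mem_pointwise_smul w x W hw
    rwa [show x • W = W from hWstab (hPH hx)] at this
  have hWcard : Nat.card W ≤ p ^ 2 := by
    have : Function.Surjective (fun z : displacementSubgroup V T × displacementSubgroup V T₁ =>
        (⟨z.1 * z.2, mul_mem (le_sup_left (a := displacementSubgroup V T) z.1.2)
          (le_sup_right (b := displacementSubgroup V T₁) z.2.2)⟩ : W)) := by
      rintro ⟨w, hw⟩
      obtain ⟨a, ha, b, hb, rfl⟩ := Subgroup.mem_sup.1 hw
      exact ⟨(⟨a, ha⟩, ⟨b, hb⟩), rfl⟩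
    refine (Nat.card_le_card_of_surjective _ this).trans ?_
    rw [Nat.card_prod, hT.card_displacementSubgroup, (hT.conj l).card_displacementSubgroup, sq]
  -- a vector of `W` fixed by `P`
  obtain ⟨w, hwW, hw1, hwP⟩ : ∃ w ∈ W, w ≠ 1 ∧ ∀ x ∈ P, x • w = w := by
    let X : SubMulAction P V :=
      { carrier := W
        smul_mem' := fun x w hw => hWmem x x.2 w hw }
    have hd : p ∣ Nat.card X := by
      rw [← hT.card_displacementSubgroup]
      exact Subgroup.card_dvd_of_le (le_sup_left : _ ≤ W)
    obtain ⟨b, hb, hb1⟩ := hP.exists_fixed_point_of_prime_dvd_card_of_fixed_point X hd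
      (a := ⟨1, one_mem W⟩) (fun x => Subtype.ext (smul_one x))
    exact ⟨b, b.2, fun h => hb1 (Subtype.ext h.symm), fun x hx => congrArg Subtype.val (hb ⟨x, hx⟩)⟩
  have hwc : w ∈ displacementSubgroup V T := by
    obtain ⟨a, ha, b, hb, rfl⟩ := Subgroup.mem_sup.1 hwW
    have hbf : b ∈ fixedSubgroup V T := by
      have := (Subgroup.mul_mem_cancel_left (fixedSubgroup V T)
        (hT.displacementSubgroup_le_fixedSubgroup ha)).1 (fun x hx => hwP x (hTP hx))
      exact this
    have : b ∈ displacementSubgroup V T₁ ⊓ fixedSubgroup V T := ⟨hb, hbf⟩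
    rw [Subgroup.inf_eq_bot_of_card_prime hc₁ h1, Subgroup.mem_bot] at this
    rwa [this, mul_one]
  have hPc' : displacementSubgroup V T ≤ fixedSubgroup V P :=
    Subgroup.eq_of_mem_of_card_prime hc hwc hwP hw1
  have hPH' : fixedSubgroup V H ≤ fixedSubgroup V P := fun v hv x hx => hv x (hPH hx)
  have hrel : ((fixedSubgroup V H).relIndex (fixedSubgroup V T)).Prime := by
    rw [hH, fixedSubgroup_sup, inf_comm, Subgroup.inf_relIndex_right,
      Subgroup.relIndex_eq_prime_of_index_eq hV (hT.conj l).index_eq hT.index_eq hne]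
    exact hp.out
  -- C_V(H) has index p in C_V(T) and does not contain [V,T], so C_V(T) = C_V(H)[V,T].
  have hPT : fixedSubgroup V T ≤ fixedSubgroup V P := by
    have hle : fixedSubgroup V H ≤ fixedSubgroup V T := fun v hv x hx =>
      hv x (le_sup_left (a := T) hx)
    rw [← Subgroup.sup_eq_of_relIndex_prime hle hT.displacementSubgroup_le_fixedSubgroup ?_ hrel]
    · exact sup_le hPH' hPc'
    · rw [hH, fixedSubgroup_sup]
      exact fun h => h2 (h.trans inf_le_right)
  obtain ⟨a, ha, haf⟩ := Set.not_subset.1 h1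
  -- C_V(T) and a generate V, so an element of P is determined by its value at a.
  have hinj : Function.Injective (fun x : P => (⟨(x : E) • a, hWmem x x.2 a
      (le_sup_right (b := displacementSubgroup V T₁) ha)⟩ : W)) := by
    intro x y hxy
    have hxy' : (x : E) • a = (y : E) • a := congrArg Subtype.val hxy
    ext1
    refine eq_of_smul_eq_smul (α := V) fun v => ?_
    obtain ⟨i, hi⟩ := Subgroup.mul_inv_zpow_mem_of_index_prime
      (K := fixedSubgroup V T) (by rw [hT.index_eq]; exact hp.out) haf v
    have hx := hPT hi x x.2
    have hy := hPT hi y y.2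
    rw [smul_mul', smul_zpow'] at hy
    rw [smul_mul', smul_zpow', hxy', ← hy] at hx
    exact mul_right_cancel hx
  -- The inequality is strict because 1 ∈ W is not an image of a.
  have hlt : Nat.card P < Nat.card W := by
    refine Nat.lt_of_le_of_ne (Nat.card_le_card_of_injective _ hinj) fun h => ?_
    have hsurj := ((Nat.bijective_iff_injective_and_card _).2 ⟨hinj, h⟩).2 1
    revert hsurj
    rintro ⟨x, hx⟩
    have : (x : E) • a = 1 := congrArg Subtype.val hx
    rw [smul_eq_iff_eq_inv_smul, smul_one] at this
    exact haf (by rw [this]; exact one_mem _)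
  exact absurd (Nat.le_of_dvd Nat.card_pos hPc) (by omega)

/-- If `H` is generated by two transvection groups conjugate in `H`, and `E = HB` where `p²` does
not divide `|B|`, then any element normalising the first transvection group preserves the subgroup
fixed by `H`. -/
theorem smul_mem_fixedSubgroup_sup [Finite V] [FaithfulSMul E V] (hV : IsPGroup p V)
    (hT : IsTransvectionGroup p V T) {l : E}
    (hl : l ∈ T ⊔ MulAut.conj l • T)
    (hne : fixedSubgroup V (MulAut.conj l • T) ≠ fixedSubgroup V T)
    {B : Subgroup E} (hTB : T ≤ B) (hB : ¬ p ^ 2 ∣ Nat.card B)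
    (hHB : ∀ e : E, ∃ h ∈ T ⊔ MulAut.conj l • T, ∃ b ∈ B, e = h * b)
    {τ : E} (hτ : MulAut.conj τ • T = T) {v : V}
    (hv : v ∈ fixedSubgroup V (T ⊔ MulAut.conj l • T)) :
    τ • v ∈ fixedSubgroup V (T ⊔ MulAut.conj l • T) := by
  set T₁ := MulAut.conj l • T with hT₁
  have hT₁' : IsTransvectionGroup p V T₁ := hT.conj l
  -- With H = ⟨T, T₁⟩, |E : B| = |H : H ∩ B|. This is prime to p, since T ≤ H ∩ B and p² does not
  -- divide |H|.
  have hE : ¬ p ^ 2 ∣ Nat.card E := by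
    have h1 := Subgroup.relIndex_eq_index_of_factor hHB
    have h2 := hT.not_sq_dvd_card_sup hV hl hne
    have h3 := (B ⊓ (T ⊔ T₁)).card_mul_relIndex (A := T ⊔ T₁) inf_le_right
    rw [Subgroup.inf_relIndex_right, h1] at h3
    rw [← B.card_mul_index]
    intro h4
    have h5 : ¬ p ∣ B.index := fun h5 => h2 (by
      rw [← h3, sq]
      refine mul_dvd_mul ?_ h5
      rw [← hT.card_eq]
      exact Subgroup.card_dvd_of_le (le_inf hTB le_sup_left))
    exact hB (Nat.Coprime.dvd_of_dvd_mul_right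
      (((Nat.Prime.coprime_iff_not_dvd hp.out).2 h5).pow_left 2) h4)
  have h1 := hT.not_displacementSubgroup_le hl hne
  set T₂ := MulAut.conj τ • T₁ with hT₂
  have hT₂' : IsTransvectionGroup p V T₂ := hT₁'.conj τ
  have hfix : fixedSubgroup V (T ⊔ T₂) = fixedSubgroup V (MulAut.conj τ • (T ⊔ T₁)) := by
    rw [Subgroup.smul_sup, hτ]
  suffices h : fixedSubgroup V (T ⊔ T₂) = fixedSubgroup V (T ⊔ T₁) by
    rw [← h, hfix, mem_fixedSubgroup_conj, inv_smul_smul]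
    exact hv
  by_cases hcase : displacementSubgroup V T₂ ≤ fixedSubgroup V T₁
  · rw [hT₁'.eq_of_displacementSubgroup_le hV hT₂' hE hcase]
  obtain ⟨a, ha, haf⟩ := Set.not_subset.1 hcase
  obtain ⟨d, hd, hdf⟩ := Set.not_subset.1 h1
  obtain ⟨i, hi⟩ := Subgroup.mul_inv_zpow_mem_of_index_prime
      (K := fixedSubgroup V T) (by rw [hT.index_eq]; exact hp.out) hdf a
  obtain ⟨x, hx, hx1⟩ := hT₁'.exists_ne_one
  have hxa : displacement V x a ≠ 1 := fun h => haf (hT₁'.fixed_of_smul_eq hx hx1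
    (by rw [smul_eq_displacement_mul, h, one_mul]))
  obtain ⟨j, hj⟩ := Subgroup.exists_zpow_eq_of_card_prime
    (by rw [hT₁'.card_displacementSubgroup]; exact hp.out) (_root_.displacement_mem hx a) hxa
    (zpow_mem hd i)
  obtain ⟨n, hn⟩ := mem_powers_iff_mem_zpowers.2 (Subgroup.mem_zpowers_iff.2 ⟨j, hj⟩)
  -- The centre [V,T₁] supplies a complement to the hyperplane C_V(T), and the powers of x shift a
  -- by every element of [V,T₁]; one shift lands in C_V(T).
  have hsa : x ^ n • a ∈ fixedSubgroup V T := by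
    rw [smul_eq_displacement_mul, hT₁'.displacement_pow hx]
    change (fun k => displacement V x a ^ k) n * a ∈ _
    rw [hn, mul_comm]
    exact hi
  have ha1 : x ^ n • a ≠ 1 := fun h => haf (by
    rw [smul_eq_iff_eq_inv_smul, smul_one] at h
    rw [h]; exact one_mem _)
  have hD := (hT₂'.conj (x ^ n))
  -- The conjugate of T₂ by x^n has centre generated by x^n • a, which T fixes, so it coincides with
  -- T. Thus T ≤ ⟨T₁, T₂⟩, and any two of the three hyperplanes C_V(T), C_V(T₁), C_V(T₂) meet in the
  -- same subgroup.
  have hDT : MulAut.conj (x ^ n) • T₂ = T := hT.eq_of_displacementSubgroup_le hV hD hE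
    (Subgroup.eq_of_mem_of_card_prime (by rw [hD.card_displacementSubgroup]; exact hp.out)
      (smul_displacementSubgroup_le ha) hsa ha1)
  have hle : fixedSubgroup V T₁ ⊓ fixedSubgroup V T₂ ≤ fixedSubgroup V T := by
    rintro v ⟨h1, h2⟩
    rw [← hDT, mem_fixedSubgroup_conj, inv_smul_eq_iff.2 (h1 _ (pow_mem hx n)).symm]
    exact h2
  have hτf : τ • fixedSubgroup V T = fixedSubgroup V T := by rw [← fixedSubgroup_conj, hτ]
  have hne₂ : fixedSubgroup V T₂ ≠ fixedSubgroup V T := by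
    rw [fixedSubgroup_conj, ← hτf]
    exact fun h => hne (smul_left_cancel _ h)
  have hne₁₂ : fixedSubgroup V T₁ ≠ fixedSubgroup V T₂ := fun h => hcase
    (h ▸ hT₂'.displacementSubgroup_le_fixedSubgroup)
  have not_le : ∀ A : Subgroup V, A.index = p → A ≠ fixedSubgroup V T →
      ¬ A ≤ fixedSubgroup V T := fun A hA hn h => hn <|
    (Subgroup.eq_or_eq_of_relIndex_prime (A := ⊤) h le_top
      (by rw [Subgroup.relIndex_top_right, hA]; exact hp.out)).elim Eq.symm fun h => by
        rw [← Subgroup.index_eq_one, hT.index_eq] at h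
        exact absurd h hp.out.one_lt.ne'
  have e₁ : fixedSubgroup V T ⊓ fixedSubgroup V T₁ = fixedSubgroup V T₁ ⊓ fixedSubgroup V T₂ :=
    (Subgroup.eq_or_eq_of_relIndex_prime (le_inf hle inf_le_left) inf_le_right
      (by rw [inf_comm, Subgroup.inf_relIndex_right, Subgroup.relIndex_eq_prime_of_index_eq hV
        hT₂'.index_eq hT₁'.index_eq hne₁₂.symm]; exact hp.out)).resolve_right
      fun h => not_le _ hT₁'.index_eq hne (inf_eq_right.1 h)
  have e₂ : fixedSubgroup V T ⊓ fixedSubgroup V T₂ = fixedSubgroup V T₁ ⊓ fixedSubgroup V T₂ :=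
    (Subgroup.eq_or_eq_of_relIndex_prime (le_inf hle inf_le_right) inf_le_right
      (by rw [Subgroup.inf_relIndex_right, Subgroup.relIndex_eq_prime_of_index_eq hV
        hT₁'.index_eq hT₂'.index_eq hne₁₂]; exact hp.out)).resolve_right
      fun h => not_le _ hT₂'.index_eq hne₂ (inf_eq_right.1 h)
  rw [fixedSubgroup_sup, fixedSubgroup_sup, e₁, e₂]

end IsTransvectionGroup

end Transvection

/-! ### From transvections to conjugation inside a group -/

namespace Subgroup

variable {G : Type*} [Group G]

theorem relIndex_map_dvd {G' : Type*} [Group G'] (f : G →* G') {K A : Subgroup G} (h : K ≤ A) :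
    (K.map f).relIndex (A.map f) ∣ K.relIndex A := by
  have h1 := index_map_dvd (K.subgroupOf A) (f.subgroupMap_surjective A)
  change _ ∣ (K.subgroupOf A).index
  convert h1 using 1
  change ((K.map f).subgroupOf (A.map f)).index = _
  congr 1
  ext ⟨y, hy⟩
  rw [mem_subgroupOf, mem_map, mem_map]
  constructor
  · rintro ⟨x, hx, rfl⟩
    exact ⟨⟨x, h hx⟩, hx, rfl⟩
  · rintro ⟨x, hx, hxy⟩
    exact ⟨x, hx, congrArg Subtype.val hxy⟩

theorem map_conj_smul {G' : Type*} [Group G'] (f : G →* G') (g : G) (K : Subgroup G) :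
    (MulAut.conj g • K).map f = MulAut.conj (f g) • K.map f := by
  ext y
  rw [mem_conj_smul, mem_map, mem_map]
  constructor
  · rintro ⟨x, hx, rfl⟩
    exact ⟨_, mem_conj_smul.1 hx, by simp⟩
  · rintro ⟨x, hx, hxy⟩
    refine ⟨g * x * g⁻¹, conj_mem_conj_smul hx, ?_⟩
    rw [map_mul, map_mul, hxy, map_inv]
    group

theorem conj_smul_eq_iff {g : G} {K : Subgroup G} :
    MulAut.conj g • K = K ↔ g ∈ normalizer (K : Set G) := by
  rw [mem_normalizer_iff_map_conj_eq]
  rfl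

open scoped IsMulCommutative in
/-- Let `H = ⟨S, l S l⁻¹⟩` with `l ∈ H` act on an abelian `p`-group `V` with `S` inducing a group of
transvections of order `p`, and let `M = HB` be a group normalising `V` where `S ≤ B` and
`p ∤ |B : S|`. Then any element of `M` normalising `S` normalises `C_V(H)`. -/
theorem conj_mem_centralizer_of_transvections [Finite G] {p : ℕ} [hp : Fact p.Prime]
    {V S B M : Subgroup G} {l τ : G} (hVp : IsPGroup p V) (hVc : V ≤ centralizer V)
    (hMV : M ≤ normalizer V) (hSB : S ≤ B) (hBM : B ≤ M)
    (hHM : S ⊔ MulAut.conj l • S ≤ M) (hl : l ∈ S ⊔ MulAut.conj l • S)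
    (hSV : (centralizer (S : Set G)).relIndex V = p)
    (hVS : (centralizer (V : Set G)).relIndex S = p)
    (hVSS : ∀ s ∈ S, ∀ v ∈ V, s * v * s⁻¹ * v⁻¹ ∈ centralizer (S : Set G))
    (hne : V ⊓ centralizer ((MulAut.conj l • S : Subgroup G) : Set G) ≠ V ⊓ centralizer S)
    (hB : ¬ p ∣ S.relIndex B)
    (hM : ∀ m ∈ M, ∃ h ∈ S ⊔ MulAut.conj l • S, ∃ b ∈ B, m = h * b)
    (hτM : τ ∈ M) (hτ : MulAut.conj τ • S = S) {v : G} (hvV : v ∈ V)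
    (hv : v ∈ centralizer ((S ⊔ MulAut.conj l • S : Subgroup G) : Set G)) :
    τ * v * τ⁻¹ ∈ centralizer ((S ⊔ MulAut.conj l • S : Subgroup G) : Set G) := by
  have : IsMulCommutative V := le_centralizer_iff_isMulCommutative.1 hVc
  -- The image of M in Aut V acts faithfully and S becomes a transvection group there; fixed
  -- subgroups become centralisers in V.
  set f : M →* MulAut V := V.normalizerMonoidHom.comp (inclusion hMV) with hf
  have hSM : S ≤ M := hSB.trans hBM
  have hlM : l ∈ M := hHM hl
  have hact : ∀ (m : M) (w : V), ((f.rangeRestrict m • w : V) : G) = m * w * (m : G)⁻¹ :=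
    fun m w => rfl
  set E := f.range
  set T : Subgroup E := (S.subgroupOf M).map f.rangeRestrict with hT
  have hfix : ∀ (K : Subgroup G), K ≤ M → fixedSubgroup V ((K.subgroupOf M).map f.rangeRestrict) =
      (centralizer (K : Set G)).subgroupOf V := by
    intro K hK
    ext w
    rw [mem_subgroupOf, mem_centralizer_iff, mem_fixedSubgroup]
    constructor
    · intro h k hk
      have := congrArg Subtype.val (h _ (mem_map_of_mem _ (x := ⟨k, hK hk⟩) hk))
      rw [hact] at this
      exact mul_inv_eq_iff_eq_mul.1 this
    · rintro h _ ⟨k, hk, rfl⟩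
      ext1
      rw [hact]
      exact mul_inv_eq_iff_eq_mul.2 (h k hk)
  have hker : f.rangeRestrict.ker = (centralizer (V : Set G)).subgroupOf M := by
    rw [MonoidHom.ker_rangeRestrict, hf, ← MonoidHom.comap_ker, normalizerMonoidHom_ker]
    rfl
  have hTt : IsTransvectionGroup p V T :=
    { card_eq := by
        rw [hT, ← relIndex_ker, hker, relIndex_subgroupOf hSM, hVS]
      index_eq := by
        rw [hT, hfix S hSM]
        exact hSV
      displacement_mem := by
        rintro _ ⟨s, hs, rfl⟩ w
        rw [hT, hfix S hSM, mem_subgroupOf]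
        exact hVSS s hs w w.2 }
  have hlT : MulAut.conj (f.rangeRestrict ⟨l, hlM⟩) • T =
      ((MulAut.conj l • S).subgroupOf M).map f.rangeRestrict := by
    rw [hT, ← map_conj_smul, conj_smul_subgroupOf hSM]
  have hsup : T ⊔ MulAut.conj (f.rangeRestrict ⟨l, hlM⟩) • T =
      ((S ⊔ MulAut.conj l • S).subgroupOf M).map f.rangeRestrict := by
    rw [hlT, hT, ← map_sup, ← subgroupOf_sup hSM (le_sup_right.trans hHM)]
  have hτT : MulAut.conj (f.rangeRestrict ⟨τ, hτM⟩) • T = T := by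
    rw [hT, ← map_conj_smul, conj_smul_subgroupOf hSM, hτ]
  have key := hTt.smul_mem_fixedSubgroup_sup hVp (l := f.rangeRestrict ⟨l, hlM⟩)
    (by rw [hsup]; exact mem_map_of_mem _ hl)
    (by
      rw [hlT, hfix _ (le_sup_right.trans hHM), hT, hfix _ hSM]
      intro h
      apply hne
      rw [inf_comm, ← subgroupOf_map_subtype, h, subgroupOf_map_subtype, inf_comm])
    (B := (B.subgroupOf M).map f.rangeRestrict) (map_mono (comap_mono hSB))
    (by
      intro h
      apply hB
      have h1 := card_mul_relIndex (K := T) (A := (B.subgroupOf M).map f.rangeRestrict)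
        (map_mono (comap_mono hSB))
      rw [hTt.card_eq] at h1
      rw [← h1, sq] at h
      refine (Nat.dvd_of_mul_dvd_mul_left hp.out.pos h).trans ?_
      rw [← relIndex_subgroupOf hBM]
      exact relIndex_map_dvd _ (comap_mono hSB))
    (by
      rintro ⟨_, m, rfl⟩
      obtain ⟨h, hh, b, hb, hm⟩ := hM m m.2
      rw [hsup]
      refine ⟨_, mem_map_of_mem _ (x := ⟨h, hHM hh⟩) hh, _, 
        mem_map_of_mem _ (x := ⟨b, hBM hb⟩) hb, ?_⟩
      rw [← map_mul]
      exact congrArg f.rangeRestrict (Subtype.ext hm))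
    hτT (v := ⟨v, hvV⟩) (by rw [hsup, hfix _ hHM]; exact hv)
  rw [hsup, hfix _ hHM, mem_subgroupOf, hact] at key
  exact key

end Subgroup
-- Pushing amalgams and shifted sequences of subgroups
open Subgroup

/-- A `p`-subgroup `S` together with elements `l`, `t` such that `S ∩ l S l⁻¹` has index `p` in `S`,
`t` normalises `S`, and no nontrivial subgroup of `S ∩ l S l⁻¹` is normalised by both
`H = ⟨S, l S l⁻¹⟩` and `t`; moreover `l ∈ H ≤ M = HB ≤ N(S ∩ l S l⁻¹)` where `S` is a Sylow
`p`-subgroup of `B` and `t² ∈ B`. -/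
structure IsPushingAmalgam {G : Type*} [Group G] (p : ℕ) (S B M : Subgroup G) (l t : G) :
    Prop where
  isPGroup : IsPGroup p S
  relIndex_eq : (MulAut.conj l • S).relIndex S = p
  mem_sup : l ∈ S ⊔ MulAut.conj l • S
  smul_eq : MulAut.conj t • S = S
  sup_le_ambient : S ⊔ MulAut.conj l • S ≤ M
  ambient_le_normalizer : M ≤ normalizer ((S ⊓ MulAut.conj l • S : Subgroup G) : Set G)
  le_left : S ≤ B
  left_le : B ≤ M
  not_dvd : ¬ p ∣ S.relIndex B
  factor : ∀ m ∈ M, ∃ h ∈ S ⊔ MulAut.conj l • S, ∃ b ∈ B, m = h * b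
  sq_mem : t * t ∈ B
  core : ∀ N : Subgroup G, N ≤ S ⊓ MulAut.conj l • S →
    S ⊔ MulAut.conj l • S ≤ normalizer (N : Set G) → MulAut.conj t • N = N → N = ⊥

section Shift

variable {G : Type*} [Group G]

/-- A sequence of subgroups indexed by `ℤ` that is shifted by conjugation by `g`. -/
def IsShift (g : G) (x : ℤ → Subgroup G) : Prop :=
  ∀ i, MulAut.conj g • x i = x (i + 1)

namespace Subgroup

theorem conj_smul_centralizer (g : G) (K : Subgroup G) :
    MulAut.conj g • centralizer (K : Set G) =
      centralizer ((MulAut.conj g • K : Subgroup G) : Set G) := by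
  ext x
  rw [mem_conj_smul, mem_centralizer_iff, mem_centralizer_iff]
  constructor
  · intro h k hk
    have := congrArg (fun y => g * y * g⁻¹) (h _ (mem_conj_smul.1 hk))
    simpa [mul_assoc] using this
  · intro h k hk
    have := h _ (conj_mem_conj_smul hk)
    have h2 := congrArg (fun y => g⁻¹ * y * g) this
    simpa [mul_assoc] using h2

theorem card_conj_smul (g : G) (K : Subgroup G) :
    Nat.card (MulAut.conj g • K : Subgroup G) = Nat.card K :=
  (Nat.card_congr (equivSMul (MulAut.conj g) K).toEquiv).symm

theorem relIndex_conj_smul (g : G) (K L : Subgroup G) :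
    (MulAut.conj g • K).relIndex (MulAut.conj g • L) = K.relIndex L :=
  relIndex_pointwise_smul _ _ _

theorem conj_smul_mono (g : G) {K L : Subgroup G} (h : K ≤ L) :
    MulAut.conj g • K ≤ MulAut.conj g • L :=
  pointwise_smul_le_pointwise_smul_iff.2 h

theorem le_normalizer_conj_smul {g : G} {K L : Subgroup G} (h : K ≤ normalizer (L : Set G)) :
    MulAut.conj g • K ≤ normalizer ((MulAut.conj g • L : Subgroup G) : Set G) := by
  intro x hx
  rw [mem_conj_smul] at hx
  have := conj_smul_eq_iff.2 (h hx)
  rw [← conj_smul_eq_iff, ← mul_smul, ← map_mul, show x * g = g * (g⁻¹ * x * g) by group, map_mul,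
    mul_smul, this]

theorem le_centralizer_comm {K L : Subgroup G} (h : K ≤ centralizer (L : Set G)) :
    L ≤ centralizer (K : Set G) :=
  le_centralizer_iff.1 h

theorem le_normalizer_of_le_centralizer {K L : Subgroup G} (h : K ≤ centralizer (L : Set G)) :
    K ≤ normalizer (L : Set G) :=
  h.trans (centralizer_le_normalizer _)

theorem le_normalizer_inf {K L N : Subgroup G} (h1 : K ≤ normalizer (L : Set G))
    (h2 : K ≤ normalizer (N : Set G)) : K ≤ normalizer ((L ⊓ N : Subgroup G) : Set G) :=
  (le_inf h1 h2).trans inf_normalizer_le_normalizer_inf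

theorem le_normalizer_of_relIndex_eq_prime {p : ℕ} [hp : Fact p.Prime] {K A : Subgroup G}
    [Finite A] (hA : IsPGroup p A) (hK : K ≤ A) (h : K.relIndex A = p) :
    A ≤ normalizer (K : Set G) := by
  rw [← normal_subgroupOf_iff_le_normalizer hK]
  obtain ⟨n, hn⟩ := IsPGroup.iff_card.1 hA
  refine normal_of_index_eq_minFac_card (h.trans ?_)
  have hn0 : n ≠ 0 := by
    rintro rfl
    have := relIndex_dvd_card K A
    rw [h, hn, pow_zero, Nat.dvd_one] at this
    exact hp.out.one_lt.ne' this
  rw [hn, Nat.pow_minFac hn0, hp.out.minFac_eq]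

end Subgroup

namespace IsShift

variable {g : G} {x y : ℤ → Subgroup G}

theorem zpow_smul (hx : IsShift g x) (i j : ℤ) : MulAut.conj (g ^ j) • x i = x (i + j) := by
  induction j with
  | zero => simp
  | succ j ih =>
    rw [zpow_add_one, (Commute.zpow_self g _).eq, map_mul, mul_smul, ih, hx, add_assoc]
  | pred j ih =>
    have h := hx (i + (-(j : ℤ) - 1))
    refine smul_left_cancel (MulAut.conj g) ?_
    rw [h, ← mul_smul, ← map_mul, ← zpow_one_add, show (1 + (-(j : ℤ) - 1)) = -j by ring, ih]
    congr 1
    ring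

theorem smul_eq (hx : IsShift g x) {i j k : ℤ} (h : j = i + k) :
    MulAut.conj (g ^ k) • x i = x j := by
  rw [hx.zpow_smul, h]

theorem le (hx : IsShift g x) (hy : IsShift g y) {a b : ℤ} (h : x a ≤ y b) {c d : ℤ}
    (e : c - a = d - b) : x c ≤ y d := by
  rw [← hx.smul_eq (i := a) (k := c - a) (by ring), ← hy.smul_eq (i := b) (k := c - a) (by omega)]
  exact conj_smul_mono _ h

theorem relIndex (hx : IsShift g x) (hy : IsShift g y) (a b : ℤ) {c d : ℤ}
    (e : c - a = d - b) : (x c).relIndex (y d) = (x a).relIndex (y b) := by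
  rw [← hx.smul_eq (i := a) (k := c - a) (by ring), ← hy.smul_eq (i := b) (k := c - a) (by omega)]
  exact relIndex_conj_smul _ _ _

theorem card (hx : IsShift g x) (a b : ℤ) : Nat.card (x a) = Nat.card (x b) := by
  rw [← hx.smul_eq (i := b) (k := a - b) (by ring), card_conj_smul]

theorem eq (hx : IsShift g x) (hy : IsShift g y) {a b : ℤ} (h : x a = y b) {c d : ℤ}
    (e : c - a = d - b) : x c = y d :=
  le_antisymm (hx.le hy h.le e) (hy.le hx h.ge e.symm)

theorem inf (hx : IsShift g x) (hy : IsShift g y) : IsShift g fun i => x i ⊓ y i := fun i => by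
  rw [smul_inf, hx, hy]

theorem add (hx : IsShift g x) (k : ℤ) : IsShift g fun i => x (i + k) := fun i => by
  rw [hx, add_right_comm]

theorem centralizer (hx : IsShift g x) :
    IsShift g fun i => Subgroup.centralizer (x i : Set G) := fun i => by
  rw [conj_smul_centralizer, hx]

end IsShift

end Shift

/-! ### Intersections of consecutive conjugates -/

namespace IsPushingAmalgam

variable {G : Type*} [Group G]

/-- The conjugates of `S` by the powers of `g`. -/
def conjSeq (g : G) (S : Subgroup G) (i : ℤ) : Subgroup G := MulAut.conj (g ^ i) • S

/-- The intersection of `n + 1` consecutive conjugates of `S`. -/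
def conjInf (g : G) (S : Subgroup G) (n : ℕ) (i : ℤ) : Subgroup G :=
  ⨅ j ∈ Finset.range (n + 1), conjSeq g S (i + j)

theorem isShift_conjSeq (g : G) (S : Subgroup G) : IsShift g (conjSeq g S) := fun i => by
  rw [conjSeq, conjSeq, ← mul_smul, ← map_mul, ← zpow_one_add, add_comm]

theorem conjSeq_zero (g : G) (S : Subgroup G) : conjSeq g S 0 = S := by simp [conjSeq]

theorem mem_conjInf {g : G} {S : Subgroup G} {n : ℕ} {i : ℤ} {x : G} :
    x ∈ conjInf g S n i ↔ ∀ j : ℤ, i ≤ j → j ≤ i + n → x ∈ conjSeq g S j := by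
  simp only [conjInf, mem_iInf, Finset.mem_range]
  constructor
  · intro h j h1 h2
    have := h (j - i).toNat (by omega)
    rwa [show i + ((j - i).toNat : ℤ) = j by omega] at this
  · intro h j hj
    exact h _ (by omega) (by omega)

theorem isShift_conjInf (g : G) (S : Subgroup G) (n : ℕ) : IsShift g (conjInf g S n) := by
  intro i
  ext x
  rw [mem_conj_smul, mem_conjInf, mem_conjInf]
  have : ∀ j, g⁻¹ * x * g ∈ conjSeq g S j ↔ x ∈ conjSeq g S (j + 1) := fun j => by
    rw [← isShift_conjSeq g S j, mem_conj_smul]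
  constructor
  · intro h j h1 h2
    have := (this _).1 (h (j - 1) (by omega) (by omega))
    rwa [sub_add_cancel] at this
  · intro h j h1 h2
    exact (this j).2 (h _ (by omega) (by omega))

theorem conjInf_le_conjSeq {g : G} {S : Subgroup G} {n : ℕ} {i j : ℤ} (h1 : i ≤ j)
    (h2 : j ≤ i + n) : conjInf g S n i ≤ conjSeq g S j := fun _ hx => mem_conjInf.1 hx j h1 h2

theorem conjInf_le_conjInf {g : G} {S : Subgroup G} {m n : ℕ} {i j : ℤ} (h1 : i ≤ j)
    (h2 : j + m ≤ i + n) : conjInf g S n i ≤ conjInf g S m j := fun _ hx =>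
  mem_conjInf.2 fun k h3 h4 => mem_conjInf.1 hx k (by omega) (by omega)

theorem conjInf_zero (g : G) (S : Subgroup G) (i : ℤ) : conjInf g S 0 i = conjSeq g S i := by
  refine le_antisymm (conjInf_le_conjSeq le_rfl (by simp)) fun x hx => mem_conjInf.2 ?_
  intro j h1 h2
  rwa [show j = i by simp at h2; omega]

theorem conjInf_succ (g : G) (S : Subgroup G) (n : ℕ) (i : ℤ) :
    conjInf g S (n + 1) i = conjInf g S n i ⊓ conjSeq g S (i + n + 1) := by
  refine le_antisymm (le_inf (conjInf_le_conjInf le_rfl (by push_cast; omega))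
    (conjInf_le_conjSeq (by omega) (by push_cast; omega))) ?_
  rintro x ⟨h1, h2⟩
  refine mem_conjInf.2 fun j h3 h4 => ?_
  by_cases h5 : j ≤ i + n
  · exact mem_conjInf.1 h1 j h3 h5
  · rwa [show j = i + n + 1 by push_cast at h4; omega]

variable {p : ℕ} {S B M : Subgroup G} {l t : G}

theorem conjSeq_one (h : IsPushingAmalgam p S B M l t) :
    conjSeq (l * t) S 1 = MulAut.conj l • S := by
  rw [conjSeq, zpow_one, map_mul, mul_smul, h.smul_eq]

/-- Since gSg⁻¹ = lSl⁻¹, such an N is normalised by H, hence by l ∈ H, hence by t = l⁻¹g. -/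
theorem core' (h : IsPushingAmalgam p S B M l t) {N : Subgroup G} (hNS : N ≤ S)
    (hSN : S ≤ normalizer (N : Set G)) (hg : MulAut.conj (l * t) • N = N) : N = ⊥ := by
  have h1 : MulAut.conj (l * t) • S = MulAut.conj l • S := by rw [map_mul, mul_smul, h.smul_eq]
  have h2 : N ≤ MulAut.conj l • S := by
    rw [← hg, ← h1]; exact conj_smul_mono _ hNS
  have h3 : MulAut.conj l • S ≤ normalizer (N : Set G) := by
    rw [← hg, ← h1]; exact le_normalizer_conj_smul hSN
  have h4 : S ⊔ MulAut.conj l • S ≤ normalizer (N : Set G) := sup_le hSN h3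
  refine h.core N (le_inf hNS h2) h4 ?_
  have h5 := conj_smul_eq_iff.2 (h4 h.mem_sup)
  rw [map_mul, mul_smul] at hg
  exact smul_left_cancel _ (hg.trans h5.symm)

theorem isPGroup_conjSeq (h : IsPushingAmalgam p S B M l t) (i : ℤ) :
    IsPGroup p (conjSeq (l * t) S i) := h.isPGroup.map _

theorem relIndex_conjSeq_succ (h : IsPushingAmalgam p S B M l t) (i : ℤ) :
    (conjSeq (l * t) S (i + 1)).relIndex (conjSeq (l * t) S i) = p := by
  rw [(isShift_conjSeq _ S).relIndex (isShift_conjSeq _ S) 1 0 (by ring), h.conjSeq_one,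
    conjSeq_zero, h.relIndex_eq]

end IsPushingAmalgam

namespace IsPushingAmalgam

variable {G : Type*} [Group G] [Finite G] {p : ℕ} {S B M : Subgroup G} {l t : G}

theorem relIndex_conjSeq_pred (h : IsPushingAmalgam p S B M l t) (i : ℤ) :
    (conjSeq (l * t) S i).relIndex (conjSeq (l * t) S (i + 1)) = p := by
  have h1 := card_mul_relIndex (K := conjSeq (l * t) S i ⊓ conjSeq (l * t) S (i + 1)) inf_le_left
  have h2 := card_mul_relIndex (K := conjSeq (l * t) S i ⊓ conjSeq (l * t) S (i + 1)) inf_le_right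
  rw [inf_relIndex_left, h.relIndex_conjSeq_succ] at h1
  rw [inf_relIndex_right, (isShift_conjSeq _ S).card (i + 1) i, ← h1] at h2
  exact Nat.eq_of_mul_eq_mul_left Nat.card_pos h2

variable [hp : Fact p.Prime]

theorem relIndex_le_of_le_conjSeq (h : IsPushingAmalgam p S B M l t) {K : Subgroup G} {i j : ℤ}
    (hK : K ≤ conjSeq (l * t) S i) (hj : j = i + 1 ∨ i = j + 1) :
    (conjSeq (l * t) S j).relIndex K ≤ p := by
  have : (conjSeq (l * t) S j).relIndex (conjSeq (l * t) S i) = p := by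
    rcases hj with rfl | rfl
    · exact h.relIndex_conjSeq_succ i
    · exact h.relIndex_conjSeq_pred j
  rw [← this]
  exact relIndex_le_of_le_right hK (by rw [this]; exact hp.out.ne_zero)

theorem relIndex_eq_of_not_le_conjSeq (h : IsPushingAmalgam p S B M l t) {K : Subgroup G} {i j : ℤ}
    (hK : K ≤ conjSeq (l * t) S i) (hj : j = i + 1 ∨ i = j + 1)
    (hn : ¬ K ≤ conjSeq (l * t) S j) : (conjSeq (l * t) S j).relIndex K = p :=
  relIndex_eq_prime_of_le ((h.isPGroup_conjSeq i).to_le hK) (h.relIndex_le_of_le_conjSeq hK hj) hn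

/-- K ∩ S_j has prime index in K, so any subgroup of K outside S_j generates K together with it. All
later generation statements come from this. -/
theorem inf_conjSeq_sup (h : IsPushingAmalgam p S B M l t) {K J : Subgroup G} {i j : ℤ}
    (hK : K ≤ conjSeq (l * t) S i) (hj : j = i + 1 ∨ i = j + 1) (hJ : J ≤ K)
    (hn : ¬ J ≤ conjSeq (l * t) S j) : K ⊓ conjSeq (l * t) S j ⊔ J = K :=
  sup_eq_of_relIndex_prime inf_le_left hJ (fun h => hn (h.trans inf_le_right)) (by
    rw [inf_relIndex_left, h.relIndex_eq_of_not_le_conjSeq hK hj fun h => hn (hJ.trans h)]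
    exact hp.out)

/-- An intersection contained in the next conjugate at either end is contained in its own shift,
which has the same order. -/
theorem conjInf_shift_invariant (g : G) {S : Subgroup G} {n : ℕ} {i : ℤ}
    (h : conjInf g S n i ≤ conjSeq g S (i + n + 1) ∨ conjInf g S n i ≤ conjSeq g S (i - 1)) :
    MulAut.conj g • conjInf g S n i = conjInf g S n i := by
  rw [isShift_conjInf]
  have hcard := (isShift_conjInf g S n).card (i + 1) i
  rcases h with h | h
  · symm
    refine eq_of_le_of_card_ge (fun x hx => mem_conjInf.2 fun j h1 h2 => ?_) hcard.le
    by_cases h3 : j ≤ i + n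
    · exact mem_conjInf.1 hx j (by omega) h3
    · rw [show j = i + n + 1 by omega]
      exact h hx
  · have hle : conjInf g S n i ≤ conjInf g S n (i - 1) := fun x hx =>
      mem_conjInf.2 fun j h1 h2 => by
        by_cases h3 : i ≤ j
        · exact mem_conjInf.1 hx j h3 (by omega)
        · rw [show j = i - 1 by omega]
          exact h hx
    have := eq_of_le_of_card_ge hle ((isShift_conjInf g S n).card _ _).le
    exact ((isShift_conjInf g S n).eq (isShift_conjInf g S n) this (by ring))

/-- J contains S_0..S_(n+1) and its shift S_(-1)..S_n. Together they generate S_0..S_n, so the run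
can be shortened until only S_0 = S is left. -/
theorem le_of_conjInf_le_aux (h : IsPushingAmalgam p S B M l t) {J : Subgroup G} (hg : l * t ∈ J)
    (n : ℕ) (hn : ∀ k ≤ n, MulAut.conj (l * t) • conjInf (l * t) S k 0 ≠ conjInf (l * t) S k 0)
    (hJ : conjInf (l * t) S n 0 ≤ J) : S ≤ J := by
  induction n with
  | zero => rwa [conjInf_zero, conjSeq_zero] at hJ
  | succ n ih =>
    refine ih (fun k hk => hn k (by omega)) ?_
    set g := l * t
    have hJ' : conjInf g S (n + 1) (-1) ≤ J := by
      have h1 := (isShift_conjInf g S (n + 1)).smul_eq (i := 0) (j := -1) (k := -1) (by ring)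
      have h2 := (conj_smul_eq_iff (g := g ^ (-1 : ℤ)) (K := J)).2
        (le_normalizer (zpow_mem hg _))
      rw [← h1, ← h2]
      exact conj_smul_mono _ hJ
    rw [← h.inf_conjSeq_sup (K := conjInf g S n 0) (J := conjInf g S (n + 1) (-1)) (i := n)
      (j := n + 1) (conjInf_le_conjSeq (by omega) (by omega)) (Or.inl rfl)
      (conjInf_le_conjInf (by omega) (by push_cast; omega))]
    · refine sup_le ?_ hJ'
      have := conjInf_succ g S n 0
      rw [zero_add] at this
      rwa [← this]
    · intro h1
      have h2 := conjInf_shift_invariant g (S := S) (n := n + 1) (i := -1) (Or.inl (by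
        convert h1 using 2; push_cast; ring))
      rw [isShift_conjInf] at h2
      apply hn (n + 1) le_rfl
      rw [isShift_conjInf]
      exact (isShift_conjInf g S (n + 1)).eq (isShift_conjInf g S (n + 1)) h2 (by ring)

/-- For the shortest invariant run, the intersection has index p in that of the run one shorter, or
is S itself. Its normaliser thus contains g and, by the descent above, S; now `core'` applies. -/
theorem conjInf_eq_bot_of_invariant (h : IsPushingAmalgam p S B M l t) (n : ℕ)
    (hn : MulAut.conj (l * t) • conjInf (l * t) S n 0 = conjInf (l * t) S n 0) :
    conjInf (l * t) S n 0 = ⊥ := by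
  classical
  have hex : ∃ n, MulAut.conj (l * t) • conjInf (l * t) S n 0 = conjInf (l * t) S n 0 := ⟨n, hn⟩
  have hmin := fun k => Nat.find_min hex (m := k)
  have hspec := Nat.find_spec hex
  have hle := Nat.find_min' hex hn
  set m := Nat.find hex
  suffices hm : conjInf (l * t) S m 0 = ⊥ by
    rw [eq_bot_iff, ← hm]
    exact conjInf_le_conjInf le_rfl (by omega)
  have hmS : conjInf (l * t) S m 0 ≤ S :=
    (conjInf_le_conjSeq (j := 0) le_rfl (by omega)).trans_eq (conjSeq_zero _ _)
  refine h.core' hmS ?_ hspec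
  rcases Nat.eq_zero_or_eq_succ_pred m with h0 | hs
  · rw [h0, conjInf_zero, conjSeq_zero]
    exact le_normalizer
  · set k := m.pred
    rw [hs] at hspec ⊢
    refine h.le_of_conjInf_le_aux (conj_smul_eq_iff.1 hspec) k (fun j hj => hmin j (by omega)) ?_
    have hK : conjInf (l * t) S k 0 ≤ conjSeq (l * t) S k :=
      conjInf_le_conjSeq (by omega) (by omega)
    refine le_normalizer_of_relIndex_eq_prime ((h.isPGroup_conjSeq k).to_le hK)
      (conjInf_le_conjInf le_rfl (by push_cast; omega)) ?_
    rw [conjInf_succ, inf_relIndex_left, h.relIndex_eq_of_not_le_conjSeq hK (Or.inl (by ring))]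
    intro hle
    exact hmin k (by omega) (conjInf_shift_invariant _ (Or.inl hle))

/-- Sims' lemma: a subgroup containing `g` and a nontrivial intersection of consecutive conjugates
of `S` contains `S`. -/
theorem le_of_conjInf_le (h : IsPushingAmalgam p S B M l t) {J : Subgroup G} (hg : l * t ∈ J)
    {n : ℕ} (hJ : conjInf (l * t) S n 0 ≤ J) (hn : conjInf (l * t) S n 0 ≠ ⊥) : S ≤ J :=
  h.le_of_conjInf_le_aux hg n (fun _ hk he => hn (eq_bot_iff.2
    ((conjInf_le_conjInf le_rfl (by omega)).trans
      (h.conjInf_eq_bot_of_invariant _ he).le))) hJ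

theorem exists_conjInf_eq_bot (h : IsPushingAmalgam p S B M l t) :
    ∃ n, conjInf (l * t) S n 0 = ⊥ := by
  by_contra! hn
  have : ∀ n, Nat.card (conjInf (l * t) S n 0) + n ≤ Nat.card S := by
    intro n
    induction n with
    | zero => rw [conjInf_zero, conjSeq_zero, add_zero]
    | succ n ih =>
      have hlt : conjInf (l * t) S (n + 1) 0 < conjInf (l * t) S n 0 := by
        refine lt_of_le_of_ne (conjInf_le_conjInf le_rfl (by push_cast; omega)) fun he => ?_
        refine hn n (h.conjInf_eq_bot_of_invariant n (conjInf_shift_invariant _ (Or.inl ?_)))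
        rw [← he]
        exact conjInf_le_conjSeq (by omega) (by push_cast; omega)
      have := Set.Finite.card_lt_card (Set.toFinite _) (SetLike.coe_ssubset_coe.2 hlt)
      simp only [SetLike.coe_sort_coe] at this
      omega
  have h1 := this (Nat.card S)
  have h2 : 0 < Nat.card (conjInf (l * t) S (Nat.card S) 0) := Nat.card_pos
  omega

theorem card_le_pow_mul (h : IsPushingAmalgam p S B M l t) (n : ℕ) (i : ℤ) :
    Nat.card S ≤ p ^ n * Nat.card (conjInf (l * t) S n i) := by
  rw [(isShift_conjInf (l * t) S n).card i 0]
  induction n with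
  | zero => rw [conjInf_zero, conjSeq_zero, pow_zero, one_mul]
  | succ n ih =>
    refine ih.trans ?_
    rw [pow_succ, mul_assoc]
    refine Nat.mul_le_mul_left _ ?_
    rw [← card_mul_relIndex (K := conjInf (l * t) S (n + 1) 0) (A := conjInf (l * t) S n 0)
      (conjInf_le_conjInf le_rfl (by push_cast; omega)), mul_comm]
    refine Nat.mul_le_mul_right _ ?_
    rw [conjInf_succ, inf_relIndex_left]
    exact h.relIndex_le_of_le_conjSeq (conjInf_le_conjSeq (j := n) (by omega) (by omega))
      (Or.inl (by ring))

end IsPushingAmalgam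

/-! ### Centres and the critical distance -/

namespace IsPushingAmalgam

section Centers

variable {G : Type*} [Group G]

/-- The centres of the conjugates of `S`. -/
def conjCenter (g : G) (S : Subgroup G) (i : ℤ) : Subgroup G :=
  conjSeq g S i ⊓ centralizer (conjSeq g S i : Set G)

/-- The centres of the intersections of two consecutive conjugates of `S`. -/
def conjInfCenter (g : G) (S : Subgroup G) (i : ℤ) : Subgroup G :=
  conjInf g S 1 i ⊓ centralizer (conjInf g S 1 i : Set G)

theorem isShift_conjCenter (g : G) (S : Subgroup G) : IsShift g (conjCenter g S) :=
  (isShift_conjSeq g S).inf (isShift_conjSeq g S).centralizer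

theorem isShift_conjInfCenter (g : G) (S : Subgroup G) : IsShift g (conjInfCenter g S) :=
  (isShift_conjInf g S 1).inf (isShift_conjInf g S 1).centralizer

theorem conjInf_one (g : G) (S : Subgroup G) (i : ℤ) :
    conjInf g S 1 i = conjSeq g S i ⊓ conjSeq g S (i + 1) := by
  have := conjInf_succ g S 0 i
  rwa [conjInf_zero, Nat.cast_zero, add_zero, zero_add] at this

theorem conjInfCenter_le_conjSeq (g : G) (S : Subgroup G) (i : ℤ) :
    conjInfCenter g S i ≤ conjSeq g S i :=
  inf_le_left.trans (conjInf_le_conjSeq le_rfl (by simp))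

theorem conjInfCenter_le_conjSeq_succ (g : G) (S : Subgroup G) (i : ℤ) :
    conjInfCenter g S i ≤ conjSeq g S (i + 1) :=
  inf_le_left.trans (conjInf_le_conjSeq (by omega) (by simp))

theorem conjInfCenter_le_centralizer_self (g : G) (S : Subgroup G) (i : ℤ) :
    conjInfCenter g S i ≤ centralizer (conjInfCenter g S i : Set G) :=
  inf_le_right.trans (centralizer_le inf_le_left)

theorem conjInf_le_centralizer (g : G) (S : Subgroup G) (i : ℤ) :
    conjInf g S 1 i ≤ centralizer (conjInfCenter g S i : Set G) :=
  le_centralizer_comm inf_le_right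

end Centers

variable {G : Type*} [Group G] {p : ℕ} {S B M : Subgroup G} {l t : G}

theorem conjInf_one_zero (h : IsPushingAmalgam p S B M l t) :
    conjInf (l * t) S 1 0 = S ⊓ MulAut.conj l • S := by
  rw [conjInf_one, conjSeq_zero, zero_add, h.conjSeq_one]

theorem smul_conjInf_of_mem (h : IsPushingAmalgam p S B M l t) {m : G} (hm : m ∈ M) :
    MulAut.conj m • conjInf (l * t) S 1 0 = conjInf (l * t) S 1 0 := by
  rw [h.conjInf_one_zero]
  exact conj_smul_eq_iff.2 (h.ambient_le_normalizer hm)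

theorem smul_conjInf_pred (h : IsPushingAmalgam p S B M l t) :
    MulAut.conj t • conjInf (l * t) S 1 (-1) = conjInf (l * t) S 1 0 := by
  refine smul_left_cancel (MulAut.conj l) ?_
  rw [← mul_smul, ← map_mul, isShift_conjInf, h.smul_conjInf_of_mem (h.sup_le_ambient h.mem_sup)]
  rfl

/-- With the previous lemma, t interchanges Q_(-1) and Q_0; this direction needs t² to normalise
Q_0. -/
theorem smul_conjInf_zero (h : IsPushingAmalgam p S B M l t) :
    MulAut.conj t • conjInf (l * t) S 1 0 = conjInf (l * t) S 1 (-1) := by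
  refine smul_left_cancel (MulAut.conj t) ?_
  rw [← mul_smul, ← map_mul, h.smul_conjInf_of_mem (h.left_le h.sq_mem), h.smul_conjInf_pred]

theorem smul_conjCenter_zero (h : IsPushingAmalgam p S B M l t) :
    MulAut.conj t • conjCenter (l * t) S 0 = conjCenter (l * t) S 0 := by
  rw [conjCenter, conjSeq_zero, smul_inf, conj_smul_centralizer, h.smul_eq]

theorem smul_conjCenter_one (h : IsPushingAmalgam p S B M l t) :
    MulAut.conj l • conjCenter (l * t) S 0 = conjCenter (l * t) S 1 := by
  rw [← h.smul_conjCenter_zero, ← mul_smul, ← map_mul, isShift_conjCenter]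
  rfl

theorem smul_conjInfCenter (h : IsPushingAmalgam p S B M l t) {m : G} (hm : m ∈ M) :
    MulAut.conj m • conjInfCenter (l * t) S 0 = conjInfCenter (l * t) S 0 := by
  rw [conjInfCenter, smul_inf, conj_smul_centralizer, h.smul_conjInf_of_mem hm]

theorem conjSeq_zero_le_ambient (h : IsPushingAmalgam p S B M l t) :
    conjSeq (l * t) S 0 ≤ M := by
  rw [conjSeq_zero]; exact le_sup_left.trans h.sup_le_ambient

theorem conjSeq_one_le_ambient (h : IsPushingAmalgam p S B M l t) :
    conjSeq (l * t) S 1 ≤ M := by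
  rw [h.conjSeq_one]; exact le_sup_right.trans h.sup_le_ambient

theorem le_normalizer_conjInf_pred (h : IsPushingAmalgam p S B M l t) :
    S ≤ normalizer (conjInf (l * t) S 1 (-1) : Set G) := by
  rw [← h.smul_conjInf_zero, ← h.smul_eq]
  refine le_normalizer_conj_smul ?_
  rw [h.smul_eq]
  exact fun x hx => conj_smul_eq_iff.1 (h.smul_conjInf_of_mem (h.left_le (h.le_left hx)))

theorem le_normalizer_conjInf_zero (h : IsPushingAmalgam p S B M l t) :
    M ≤ normalizer (conjInf (l * t) S 1 0 : Set G) :=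
  fun _ hx => conj_smul_eq_iff.1 (h.smul_conjInf_of_mem hx)

theorem le_normalizer_conjInfCenter (h : IsPushingAmalgam p S B M l t) :
    M ≤ normalizer (conjInfCenter (l * t) S 0 : Set G) :=
  fun _ hx => conj_smul_eq_iff.1 (h.smul_conjInfCenter hx)

theorem conjCenter_le_conjInfCenter
    (hZ : conjCenter (l * t) S 0 ≤ conjInf (l * t) S 1 0) (i : ℤ) :
    conjCenter (l * t) S i ≤ conjInfCenter (l * t) S i := by
  refine le_inf ((isShift_conjCenter _ S).le (isShift_conjInf _ S 1) hZ (by ring))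
    (inf_le_right.trans (centralizer_le (conjInf_le_conjSeq le_rfl (by simp))))

theorem conjCenter_succ_le_conjInfCenter (h : IsPushingAmalgam p S B M l t)
    (hZ : conjCenter (l * t) S 0 ≤ conjInf (l * t) S 1 0) (i : ℤ) :
    conjCenter (l * t) S (i + 1) ≤ conjInfCenter (l * t) S i := by
  have hZ' : conjCenter (l * t) S 0 ≤ conjInf (l * t) S 1 (-1) := by
    rw [← h.smul_conjCenter_zero, ← h.smul_conjInf_zero]
    exact conj_smul_mono _ hZ
  refine le_inf ((isShift_conjCenter _ S).le (isShift_conjInf _ S 1) hZ' (by ring))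
    (inf_le_right.trans (centralizer_le (conjInf_le_conjSeq (by omega) (by simp))))

variable [Finite G] [hp : Fact p.Prime]

theorem conjCenter_ne_bot (h : IsPushingAmalgam p S B M l t) (i : ℤ) :
    conjCenter (l * t) S i ≠ ⊥ := by
  have h0 : conjCenter (l * t) S 0 ≠ ⊥ := by
    have hS : Nontrivial S := by
      rw [Subgroup.nontrivial_iff_ne_bot]
      rintro rfl
      have := h.relIndex_eq
      rw [relIndex_bot_right] at this
      exact hp.out.one_lt.ne this
    have := h.isPGroup.center_nontrivial
    obtain ⟨⟨x, hx⟩, hx1⟩ := exists_ne (1 : center S)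
    intro h0
    have : (x : G) ∈ conjCenter (l * t) S 0 := by
      rw [conjCenter, conjSeq_zero]
      exact ⟨x.2, mem_centralizer_iff.2 fun y hy =>
        congrArg Subtype.val (mem_center_iff.1 hx ⟨y, hy⟩)⟩
    rw [h0, mem_bot] at this
    exact hx1 (Subtype.ext (Subtype.ext this))
  intro hi
  apply h0
  rw [← (isShift_conjCenter (l * t) S).smul_eq (i := i) (k := -i) (by ring), hi, smul_bot]

/-- If the centre of `S` is not contained in `S ∩ l S l⁻¹`, then `|S| ≤ p²`. -/
theorem card_le_of_not_conjCenter_le (h : IsPushingAmalgam p S B M l t)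
    (hZ : ¬ conjCenter (l * t) S 0 ≤ conjInf (l * t) S 1 0) : Nat.card S ≤ p ^ 2 := by
  set g := l * t with hg
  have hZ1 : ¬ conjCenter g S 1 ≤ conjSeq g S 0 := by
    intro h1
    have h2 : conjCenter g S 1 ≤ conjInf g S 1 0 := by
      rw [conjInf_one]; exact le_inf h1 inf_le_left
    rw [← h.smul_conjCenter_one,
      ← h.smul_conjInf_of_mem (h.sup_le_ambient h.mem_sup)] at h2
    exact hZ (pointwise_smul_le_pointwise_smul_iff.1 h2)
  set N := conjInf g S 1 0 ⊓ conjInf g S 1 (-1) with hN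
  have hSN : S ≤ normalizer (N : Set G) :=
    le_normalizer_inf (((le_sup_left).trans h.sup_le_ambient).trans h.le_normalizer_conjInf_zero)
      h.le_normalizer_conjInf_pred
  -- S_1 is generated by S_0 ∩ S_1 and Z_1, and Z_1 centralises N ≤ S_1.
  have hs1 : conjSeq g S 1 ≤ normalizer (N : Set G) := by
    rw [← h.inf_conjSeq_sup (K := conjSeq g S 1) (J := conjCenter g S 1) (i := 1) (j := 0) le_rfl
      (Or.inr rfl) inf_le_left hZ1]
    refine sup_le ((inf_le_right.trans_eq (conjSeq_zero _ _)).trans hSN) ?_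
    refine le_normalizer_of_le_centralizer (inf_le_right.trans (centralizer_le ?_))
    exact inf_le_left.trans (conjInf_le_conjSeq (by omega) (by simp))
  have hNbot : N = ⊥ := by
    refine h.core N (inf_le_left.trans_eq h.conjInf_one_zero) ?_ ?_
    · rw [← h.conjSeq_one]
      exact sup_le hSN hs1
    · rw [hN, smul_inf, h.smul_conjInf_pred, h.smul_conjInf_zero, inf_comm]
  refine (h.card_le_pow_mul 2 (-1)).trans ?_
  have : conjInf (l * t) S 2 (-1) = ⊥ := by
    rw [eq_bot_iff, ← hNbot]
    exact le_inf (conjInf_le_conjInf (by omega) (by simp)) (conjInf_le_conjInf (by omega) (by simp))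
  rw [this, card_bot, mul_one]

/-- Equality would make the nontrivial group Z_0 invariant under g, and S centralises Z_0. -/
theorem conjCenter_ne_succ (h : IsPushingAmalgam p S B M l t) (i : ℤ) :
    conjCenter (l * t) S i ≠ conjCenter (l * t) S (i + 1) := by
  intro he
  have he' : conjCenter (l * t) S 0 = conjCenter (l * t) S (0 + 1) :=
    (isShift_conjCenter _ S).eq (isShift_conjCenter _ S) he (by ring)
  rw [← isShift_conjCenter] at he'
  refine h.conjCenter_ne_bot 0 (h.core' ?_ ?_ he'.symm)
  · exact inf_le_left.trans_eq (conjSeq_zero _ _)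
  · refine le_normalizer_of_le_centralizer (le_centralizer_comm ?_)
    rw [conjCenter, conjSeq_zero]
    exact inf_le_right

/-- Otherwise V_i = Z_(i+1). But V_i also contains Z_i, of the same order, so consecutive centres
would agree. -/
theorem not_conjInfCenter_le_centralizer_succ (h : IsPushingAmalgam p S B M l t)
    (hZ : conjCenter (l * t) S 0 ≤ conjInf (l * t) S 1 0) (i : ℤ) :
    ¬ conjInfCenter (l * t) S i ≤ centralizer (conjSeq (l * t) S (i + 1) : Set G) := by
  intro h1
  have h2 : conjInfCenter (l * t) S i = conjCenter (l * t) S (i + 1) :=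
    le_antisymm (le_inf (conjInfCenter_le_conjSeq_succ _ _ _) h1)
      (h.conjCenter_succ_le_conjInfCenter hZ i)
  have h3 := (conjCenter_le_conjInfCenter hZ i).trans_eq h2
  exact h.conjCenter_ne_succ i (eq_of_le_of_card_ge h3
    ((isShift_conjCenter _ S).card _ _).le)

theorem not_conjInfCenter_le_centralizer (h : IsPushingAmalgam p S B M l t)
    (hZ : conjCenter (l * t) S 0 ≤ conjInf (l * t) S 1 0) (i : ℤ) :
    ¬ conjInfCenter (l * t) S i ≤ centralizer (conjSeq (l * t) S i : Set G) := by
  intro h1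
  have h2 : conjInfCenter (l * t) S i = conjCenter (l * t) S i :=
    le_antisymm (le_inf (conjInfCenter_le_conjSeq _ _ _) h1)
      (conjCenter_le_conjInfCenter hZ i)
  have h3 := (h.conjCenter_succ_le_conjInfCenter hZ i).trans_eq h2
  exact h.conjCenter_ne_succ i (eq_of_le_of_card_ge h3
    ((isShift_conjCenter _ S).card _ _).le).symm

/-- The critical distance `b`: the centre of `S_0 ∩ S_1` is contained in exactly the `2b`
conjugates `S_{1-b}, …, S_b`, and it does not commute with its shift by `b`. -/
structure IsCritical (g : G) (S : Subgroup G) (b : ℕ) : Prop where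
  pos : 0 < b
  le_conjSeq : ∀ i j : ℤ, i - b < j → j ≤ i + b → conjInfCenter g S i ≤ conjSeq g S j
  not_le : ∀ i : ℤ, ¬ conjInfCenter g S i ≤ conjSeq g S (i + b + 1)
  not_le' : ∀ i : ℤ, ¬ conjInfCenter g S i ≤ conjSeq g S (i - b)
  not_commute : ∀ i : ℤ, ¬ conjInfCenter g S i ≤ centralizer (conjInfCenter g S (i + b) : Set G)

/-- b is the least distance at which V_0 leaves Q_b or V_b leaves Q_0. It exists because otherwise
V_0 would lie in every S_j with j ≥ 0, and these intersect trivially. -/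
theorem exists_isCritical (h : IsPushingAmalgam p S B M l t)
    (hZ : conjCenter (l * t) S 0 ≤ conjInf (l * t) S 1 0) : ∃ b, IsCritical (l * t) S b := by
  classical
  set g := l * t with hg
  have hV := isShift_conjInfCenter g S
  have hQ := isShift_conjInf g S 1
  have hs := isShift_conjSeq g S
  have hex : ∃ b : ℕ, ¬ conjInfCenter g S 0 ≤ conjInf g S 1 b ∨
      ¬ conjInfCenter g S b ≤ conjInf g S 1 0 := by
    by_contra! hcon
    obtain ⟨n, hn⟩ := h.exists_conjInf_eq_bot
    refine h.conjCenter_ne_bot 0 (eq_bot_iff.2 ?_)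
    rw [← hn]
    refine (conjCenter_le_conjInfCenter hZ 0).trans fun x hx => mem_conjInf.2 fun j h1 h2 => ?_
    lift j to ℕ using h1
    exact conjInf_le_conjSeq le_rfl (by simp) ((hcon j).1 hx)
  have hspec := Nat.find_spec hex
  have hmin : ∀ k < Nat.find hex, _ := fun k hk => Nat.find_min hex hk
  set b := Nat.find hex with hb
  push Not at hmin
  have hpos : 0 < b := by
    by_contra! h0
    have h0' : b = 0 := by omega
    rw [h0', Nat.cast_zero] at hspec
    exact hspec.elim (fun h => h inf_le_left) (fun h => h inf_le_left)
  have hle : ∀ i j : ℤ, i - b < j → j ≤ i + b → conjInfCenter g S i ≤ conjSeq g S j := by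
    intro i j h1 h2
    rcases lt_or_ge j (i + 1) with h3 | h3
    · have := (hmin (i - j).toNat (by omega)).2
      exact (hV.le hQ this (c := i) (d := j) (by omega)).trans
        (conjInf_le_conjSeq le_rfl (by simp))
    · have := (hmin (j - 1 - i).toNat (by omega)).1
      exact (hV.le hQ this (c := i) (d := j - 1) (by omega)).trans
        (conjInf_le_conjSeq (by omega) (by simp))
  -- If V_0 leaves Q_b, then S_b = ⟨Q_b, V_0⟩ would centralise V_b; if V_b leaves Q_0, then S_1 =
  -- ⟨Q_0, V_b⟩ would centralise V_0. Conversely either containment would force commutation, so both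
  -- fail.
  have hnc : ¬ conjInfCenter g S 0 ≤ centralizer (conjInfCenter g S b : Set G) := by
    intro hcomm
    rcases hspec with h1 | h1
    · have h2 : ¬ conjInfCenter g S 0 ≤ conjSeq g S (b + 1) := fun h2 => h1 (by
        rw [conjInf_one]; exact le_inf (hle 0 b (by omega) (by omega)) h2)
      apply h.not_conjInfCenter_le_centralizer hZ b
      apply le_centralizer_comm
      rw [← h.inf_conjSeq_sup le_rfl (Or.inl rfl) (hle 0 b (by omega) (by omega)) h2,
        ← conjInf_one]
      exact sup_le (conjInf_le_centralizer _ _ _) hcomm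
    · have hb1 := hle b 1 (by omega) (by omega)
      have h2 : ¬ conjInfCenter g S b ≤ conjSeq g S 0 := fun h2 => h1 (by
        rw [conjInf_one]; exact le_inf h2 hb1)
      apply h.not_conjInfCenter_le_centralizer_succ hZ 0
      apply le_centralizer_comm
      rw [zero_add, ← h.inf_conjSeq_sup (i := 1) (j := 0) le_rfl (Or.inr rfl) hb1 h2, inf_comm]
      refine sup_le ?_ (le_centralizer_comm hcomm)
      have := conjInf_le_centralizer g S 0
      rwa [conjInf_one] at this
  have hn1 : ¬ conjInfCenter g S 0 ≤ conjSeq g S (b + 1) := by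
    intro h1
    apply hnc
    refine le_trans ?_ (conjInf_le_centralizer g S b)
    rw [conjInf_one]
    exact le_inf (hle 0 b (by omega) (by omega)) h1
  have hn2 : ¬ conjInfCenter g S b ≤ conjSeq g S 0 := by
    intro h1
    apply hnc
    apply le_centralizer_comm
    refine le_trans ?_ (conjInf_le_centralizer g S 0)
    rw [conjInf_one]
    exact le_inf h1 (hle b 1 (by omega) (by omega))
  exact ⟨b, hpos, hle, fun i h1 => hn1 (hV.le hs h1 (by ring)),
    fun i h1 => hn2 (hV.le hs h1 (by ring)),
    fun i h1 => hnc (hV.le (hV.add b).centralizer (a := i) (b := i) h1 (c := 0) (d := 0)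
      (by ring) |>.trans_eq (by simp only [zero_add]))⟩

end IsPushingAmalgam

/-! ### Indices of centres, and three consecutive centres -/

theorem Subgroup.exists_mul_of_mem_sup {G : Type*} [Group G] {A B : Subgroup G}
    (h : A ≤ normalizer (B : Set G)) {x : G} (hx : x ∈ A ⊔ B) : ∃ a ∈ A, ∃ b ∈ B, a * b = x := by
  have : x ∈ ((A ⊔ B : Subgroup G) : Set G) := hx
  rw [coe_mul_of_left_le_normalizer_right A B h] at this
  exact Set.mem_mul.1 this

theorem Subgroup.commutator_sup_eq {G : Type*} [Group G] {F V : Subgroup G}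
    (h : V ≤ centralizer ((F ⊔ V : Subgroup G) : Set G)) : ⁅F ⊔ V, F ⊔ V⁆ = ⁅F, F⁆ := by
  refine le_antisymm (commutator_le.2 ?_) (commutator_mono le_sup_left le_sup_left)
  have hVF := le_centralizer_comm (h.trans (centralizer_le (SetLike.coe_subset_coe.2 le_sup_left)))
  intro x hx y hy
  obtain ⟨f, hf, v, hv, rfl⟩ := exists_mul_of_mem_sup (le_normalizer_of_le_centralizer hVF) hx
  obtain ⟨f', hf', v', hv', rfl⟩ := exists_mul_of_mem_sup (le_normalizer_of_le_centralizer hVF) hy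
  have h1 := mem_centralizer_iff.1 (h hv) f (mem_sup_left hf)
  have h2 := mem_centralizer_iff.1 (h hv) f' (mem_sup_left hf')
  have h3 := mem_centralizer_iff.1 (h hv') f (mem_sup_left hf)
  have h4 := mem_centralizer_iff.1 (h hv) v' (mem_sup_right hv')
  have : ⁅f * v, f' * v'⁆ = ⁅f, f'⁆ := by
    have e : f * v * (f' * v') = f * f' * (v' * v) := by
      rw [mul_assoc, ← mul_assoc v, ← h2, mul_assoc f', h4, ← mul_assoc]
    have e' : f' * v' * (f * v) = f' * f * (v' * v) := by
      rw [mul_assoc, ← mul_assoc v', ← h3, mul_assoc f, ← mul_assoc]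
    rw [commutatorElement_def, commutatorElement_def, mul_assoc _ (f * v)⁻¹, ← mul_inv_rev, e, e']
    group
  rw [this]
  exact commutator_mem_commutator hf hf'

theorem Subgroup.sq_eq_one_of_mem_sup {G : Type*} [Group G] {A B : Subgroup G}
    (h : A ≤ centralizer (B : Set G)) (hA : ∀ x ∈ A, x ^ 2 = 1) (hB : ∀ x ∈ B, x ^ 2 = 1) {x : G}
    (hx : x ∈ A ⊔ B) : x ^ 2 = 1 := by
  obtain ⟨a, ha, b, hb, rfl⟩ := exists_mul_of_mem_sup (le_normalizer_of_le_centralizer h) hx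
  have : Commute a b := (mem_centralizer_iff.1 (h ha) b hb).symm
  rw [this.mul_pow, hA a ha, hB b hb, one_mul]

namespace IsPushingAmalgam

variable {G : Type*} [Group G] {p : ℕ} {S B M : Subgroup G} {l t : G}

theorem conjSeq_le_normalizer_conjInfCenter (h : IsPushingAmalgam p S B M l t) {i j : ℤ}
    (hj : j = i ∨ j = i + 1) :
    conjSeq (l * t) S j ≤ normalizer (conjInfCenter (l * t) S i : Set G) := by
  have key : ∀ k : ℤ, conjSeq (l * t) S k ≤ M →
      conjSeq (l * t) S (k + i) ≤ normalizer (conjInfCenter (l * t) S i : Set G) := by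
    intro k hk
    rw [← (isShift_conjSeq (l * t) S).smul_eq (i := k) (k := i) rfl,
      ← (isShift_conjInfCenter (l * t) S).smul_eq (i := 0) (k := i) (by ring)]
    exact le_normalizer_conj_smul (hk.trans h.le_normalizer_conjInfCenter)
  rcases hj with rfl | rfl
  · simpa using key 0 h.conjSeq_zero_le_ambient
  · simpa [add_comm] using key 1 h.conjSeq_one_le_ambient

theorem conjSeq_le_normalizer_conjInf (h : IsPushingAmalgam p S B M l t) {i j : ℤ}
    (hj : j = i ∨ j = i + 1) :
    conjSeq (l * t) S j ≤ normalizer (conjInf (l * t) S 1 i : Set G) := by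
  have key : ∀ k : ℤ, conjSeq (l * t) S k ≤ M →
      conjSeq (l * t) S (k + i) ≤ normalizer (conjInf (l * t) S 1 i : Set G) := by
    intro k hk
    rw [← (isShift_conjSeq (l * t) S).smul_eq (i := k) (k := i) rfl,
      ← (isShift_conjInf (l * t) S 1).smul_eq (i := 0) (k := i) (by ring)]
    exact le_normalizer_conj_smul (hk.trans h.le_normalizer_conjInf_zero)
  rcases hj with rfl | rfl
  · simpa using key 0 h.conjSeq_zero_le_ambient
  · simpa [add_comm] using key 1 h.conjSeq_one_le_ambient

theorem IsCritical.le_centralizer {g : G} {S : Subgroup G} {b : ℕ} (hb : IsCritical g S b)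
    {i j : ℤ} (h1 : i < j + b) (h2 : j < i + b) :
    conjInfCenter g S i ≤ centralizer (conjInfCenter g S j : Set G) := by
  refine le_trans ?_ (conjInf_le_centralizer g S j)
  rw [conjInf_one]
  exact le_inf (hb.le_conjSeq i j (by omega) (by omega)) (hb.le_conjSeq i _ (by omega) (by omega))

theorem IsCritical.le_conjInf {g : G} {S : Subgroup G} {b : ℕ} (hb : IsCritical g S b)
    {i j : ℤ} {n : ℕ} (h1 : i - b < j) (h2 : j + n ≤ i + b) :
    conjInfCenter g S i ≤ conjInf g S n j := fun _ hx =>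
  mem_conjInf.2 fun k _ _ => hb.le_conjSeq i k (by omega) (by omega) hx

variable [Finite G] [hp : Fact p.Prime] {b : ℕ}

/-- S_(i+1) is generated by Q_i, which centralises V_i, and V_(i+b), which centralises Q_(i+b) and
so the part of V_i inside S_(i+b+1). -/
theorem IsCritical.inf_le_succ (hb : IsCritical (l * t) S b) (h : IsPushingAmalgam p S B M l t)
    (i : ℤ) : conjInfCenter (l * t) S i ⊓ conjSeq (l * t) S (i + b + 1) ≤
      conjCenter (l * t) S (i + 1) := by
  have hpos := hb.pos
  refine le_inf (inf_le_left.trans (conjInfCenter_le_conjSeq_succ _ _ _)) ?_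
  apply le_centralizer_comm
  rw [← h.inf_conjSeq_sup (K := conjSeq (l * t) S (i + 1)) (J := conjInfCenter (l * t) S (i + b))
    (j := i) le_rfl (Or.inr rfl) (hb.le_conjSeq _ _ (by omega) (by omega)) (by
      have := hb.not_le' (i + b); rwa [add_sub_cancel_right] at this)]
  rw [inf_comm, ← conjInf_one]
  refine sup_le ((conjInf_le_centralizer _ _ _).trans (centralizer_le inf_le_left)) ?_
  apply le_centralizer_comm
  refine le_trans ?_ (conjInf_le_centralizer _ _ _)
  rw [conjInf_one]
  exact inf_le_inf_right _ (hb.le_conjSeq _ _ (by omega) (by omega))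

theorem IsCritical.inf_le (hb : IsCritical (l * t) S b) (h : IsPushingAmalgam p S B M l t)
    (i : ℤ) : conjInfCenter (l * t) S i ⊓ conjSeq (l * t) S (i - b) ≤
      conjCenter (l * t) S i := by
  have hpos := hb.pos
  refine le_inf (inf_le_left.trans (conjInfCenter_le_conjSeq _ _ _)) ?_
  apply le_centralizer_comm
  rw [← h.inf_conjSeq_sup (K := conjSeq (l * t) S i) (J := conjInfCenter (l * t) S (i - b))
    (j := i + 1) le_rfl (Or.inl rfl) (hb.le_conjSeq _ _ (by omega) (by omega)) (by
      have := hb.not_le (i - b); rwa [sub_add_cancel] at this)]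
  rw [← conjInf_one]
  refine sup_le ((conjInf_le_centralizer _ _ _).trans (centralizer_le inf_le_left)) ?_
  apply le_centralizer_comm
  refine le_trans ?_ (conjInf_le_centralizer _ _ _)
  rw [conjInf_one, inf_comm]
  exact inf_le_inf_left _ (hb.le_conjSeq _ _ (by omega) (by omega))

theorem relIndex_conjCenter_eq (h : IsPushingAmalgam p S B M l t)
    {Z V : Subgroup G} {i j : ℤ} (hV : V ≤ conjSeq (l * t) S i) (hj : j = i + 1 ∨ i = j + 1)
    (hle : V ⊓ conjSeq (l * t) S j ≤ Z) (hn : ¬ V ≤ Z) : Z.relIndex V = p := by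
  refine relIndex_eq_prime_of_le ((h.isPGroup_conjSeq i).to_le hV) ?_ hn
  refine le_trans ?_ (h.relIndex_le_of_le_conjSeq hV hj)
  rw [← inf_relIndex_left V (conjSeq (l * t) S j)]
  exact relIndex_le_of_le_left hle index_ne_zero_of_finite

theorem IsCritical.relIndex_succ (hb : IsCritical (l * t) S b) (h : IsPushingAmalgam p S B M l t)
    (hZ : conjCenter (l * t) S 0 ≤ conjInf (l * t) S 1 0) (i : ℤ) :
    (conjCenter (l * t) S (i + 1)).relIndex (conjInfCenter (l * t) S i) = p :=
  h.relIndex_conjCenter_eq (hb.le_conjSeq i (i + b) (by have := hb.pos; omega) le_rfl)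
    (Or.inl rfl) (hb.inf_le_succ h i) fun h1 =>
      h.not_conjInfCenter_le_centralizer_succ hZ i (h1.trans inf_le_right)

theorem IsCritical.relIndex (hb : IsCritical (l * t) S b) (h : IsPushingAmalgam p S B M l t)
    (hZ : conjCenter (l * t) S 0 ≤ conjInf (l * t) S 1 0) (i : ℤ) :
    (conjCenter (l * t) S i).relIndex (conjInfCenter (l * t) S i) = p :=
  h.relIndex_conjCenter_eq (i := i - b + 1)
    (hb.le_conjSeq i _ (by omega) (by have := hb.pos; omega))
    (Or.inr rfl) (hb.inf_le h i) fun h1 =>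
      h.not_conjInfCenter_le_centralizer hZ i (h1.trans inf_le_right)

/-- V_i and V_(i+b) normalise each other, so the commutator lies in both; each of them then places
it in the conjugate that the other one leaves. -/
theorem IsCritical.commutator_mem (hb : IsCritical (l * t) S b) (h : IsPushingAmalgam p S B M l t)
    {i : ℤ} {a d : G} (ha : a ∈ conjInfCenter (l * t) S i)
    (hd : d ∈ conjInfCenter (l * t) S (i + b)) :
    a * d * a⁻¹ * d⁻¹ ∈ conjCenter (l * t) S (i + 1) ∧
      a * d * a⁻¹ * d⁻¹ ∈ conjCenter (l * t) S (i + b) := by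
  have hpos := hb.pos
  have h1 : a * d * a⁻¹ * d⁻¹ ∈ conjInfCenter (l * t) S i := by
    have := (mem_normalizer_iff.1 (h.conjSeq_le_normalizer_conjInfCenter (Or.inr rfl)
      (hb.le_conjSeq (i + b) (i + 1) (by omega) (by omega) hd)) a⁻¹).1 (inv_mem ha)
    simpa only [mul_assoc] using mul_mem ha this
  have h2 : a * d * a⁻¹ * d⁻¹ ∈ conjInfCenter (l * t) S (i + b) := by
    have := (mem_normalizer_iff.1 (h.conjSeq_le_normalizer_conjInfCenter (Or.inl rfl)
      (hb.le_conjSeq i (i + b) (by omega) (by omega) ha)) d).1 hd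
    exact mul_mem this (inv_mem hd)
  exact ⟨hb.inf_le_succ h i ⟨h1, hb.le_conjSeq (i + b) (i + b + 1) (by omega) (by omega) h2⟩,
    hb.inf_le h (i + b) ⟨h2, hb.le_conjSeq i _ (by omega) (by omega) h1⟩⟩

theorem IsCritical.exists_ne_one (hb : IsCritical (l * t) S b) (h : IsPushingAmalgam p S B M l t)
    (i : ℤ) : ∃ r ≠ 1, r ∈ conjCenter (l * t) S (i + 1) ∧ r ∈ conjCenter (l * t) S (i + b) := by
  obtain ⟨a, ha, hn⟩ := SetLike.not_le_iff_exists.1 (hb.not_commute i)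
  rw [mem_centralizer_iff] at hn
  push Not at hn
  obtain ⟨d, hd, hne⟩ := hn
  refine ⟨_, fun h1 => hne ?_, hb.commutator_mem h ha hd⟩
  rw [mul_inv_eq_one, mul_inv_eq_iff_eq_mul] at h1
  exact h1.symm

/-- Y = Z_0 ∩ Z_1 is C_(V_0)(H), and the transvection lemma shows that t² normalises it. Then t
interchanges Y with Y' = Z_(-1) ∩ Z_0, so Y ∩ Y' is normalised by t, is centralised by H, and is
trivial by `core`. -/
theorem IsCritical.conjCenter_inf_eq (hb : IsCritical (l * t) S b)
    (h : IsPushingAmalgam p S B M l t)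
    (hZ : conjCenter (l * t) S 0 ≤ conjInf (l * t) S 1 0) (i : ℤ) :
    conjCenter (l * t) S i ⊓ conjCenter (l * t) S (i + 1) ⊓ conjCenter (l * t) S (i + 2) = ⊥ := by
  set g := l * t with hg
  have hpos := hb.pos
  have hzs := isShift_conjCenter g S
  have hVS : conjInfCenter g S 0 ≤ S :=
    (conjInfCenter_le_conjSeq _ _ _).trans_eq (conjSeq_zero _ _)
  have hZ0 : conjInfCenter g S 0 ⊓ centralizer (S : Set G) = conjCenter g S 0 := by
    refine le_antisymm (inf_le_inf_right _ hVS |>.trans_eq ?_) (le_inf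
      (conjCenter_le_conjInfCenter hZ 0) (inf_le_right.trans_eq ?_))
    · rw [conjCenter, conjSeq_zero]
    · rw [conjSeq_zero]
  have hZ1 : conjInfCenter g S 0 ⊓ centralizer ((MulAut.conj l • S : Subgroup G) : Set G) =
      conjCenter g S 1 := by
    rw [← h.conjSeq_one]
    exact le_antisymm (inf_le_inf_right _ (conjInfCenter_le_conjSeq_succ _ _ _))
      (le_inf (h.conjCenter_succ_le_conjInfCenter hZ 0) inf_le_right)
  set Y := conjCenter g S 0 ⊓ conjCenter g S 1 with hY
  have hYH : Y ≤ centralizer ((S ⊔ MulAut.conj l • S : Subgroup G) : Set G) := by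
    apply le_centralizer_comm
    refine sup_le (le_centralizer_comm ?_) (le_centralizer_comm ?_)
    · exact inf_le_left.trans (hZ0.ge.trans inf_le_right)
    · exact inf_le_right.trans (hZ1.ge.trans inf_le_right)
  have hYl : MulAut.conj l • Y = Y :=
    conj_smul_eq_iff.2 (le_normalizer_of_le_centralizer (le_centralizer_comm hYH) h.mem_sup)
  have htt : MulAut.conj (t * t) • Y = Y := by
    refine eq_of_le_of_card_ge ?_ (card_conj_smul _ _).ge
    intro x hx
    rw [mem_conj_smul] at hx
    have hxV := conjCenter_le_conjInfCenter hZ 0 hx.1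
    have key := conj_mem_centralizer_of_transvections (V := conjInfCenter g S 0) (τ := t * t)
      ((h.isPGroup_conjSeq 0).to_le (conjInfCenter_le_conjSeq _ _ _))
      (conjInfCenter_le_centralizer_self _ _ _) h.le_normalizer_conjInfCenter
      h.le_left h.left_le h.sup_le_ambient h.mem_sup
      (by rw [← inf_relIndex_left, hZ0, hb.relIndex h hZ])
      (by
        refine h.relIndex_conjCenter_eq (i := 0) (j := 1)
          (conjSeq_zero g S).ge (Or.inl (by ring)) ?_ ?_
        · refine le_trans ?_ (conjInf_le_centralizer g S 0)
          rw [conjInf_one, conjSeq_zero, zero_add]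
        · intro h1
          apply h.not_conjInfCenter_le_centralizer hZ 0
          apply le_centralizer_comm
          rwa [conjSeq_zero])
      -- [V_0,S] ≤ Z_0: S is V_(-b)Q_0 and Q_0 centralises V_0, so only commutators with V_(-b)
      -- matter.
      (by
        intro s hs v hv
        rw [← conjSeq_zero g S] at hs
        rw [← h.inf_conjSeq_sup (K := conjSeq g S 0) (J := conjInfCenter g S (-b)) (i := 0)
          (j := 1) le_rfl (Or.inl (by ring)) (hb.le_conjSeq _ _ (by omega) (by omega)) (by
            have := hb.not_le (-b); rwa [neg_add_cancel, zero_add] at this), sup_comm] at hs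
        have hQ := conjInf_one g S 0
        rw [zero_add] at hQ
        rw [← hQ] at hs
        obtain ⟨d, hd, q, hq, rfl⟩ := exists_mul_of_mem_sup
          ((hb.le_conjSeq (-b) 0 (by omega) (by omega)).trans
            (h.conjSeq_le_normalizer_conjInf (Or.inl rfl))) hs
        have h1 := (hb.commutator_mem h (i := -b) hd (d := v) (by rwa [neg_add_cancel])).2
        rw [neg_add_cancel, ← hZ0] at h1
        have h2 : v * q = q * v := mem_centralizer_iff.1 (conjInf_le_centralizer g S 0 hq) v hv
        have h3 : d * q * v * (d * q)⁻¹ * v⁻¹ = d * v * d⁻¹ * v⁻¹ := by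
          rw [mul_assoc d, ← h2]; group
        rw [h3]
        exact h1.2)
      (by rw [hZ0, hZ1]; exact (h.conjCenter_ne_succ 0).symm)
      h.not_dvd h.factor (h.left_le h.sq_mem)
      (by rw [map_mul, mul_smul, h.smul_eq, h.smul_eq]) (v := (t * t)⁻¹ * x * (t * t)) hxV (hYH hx)
    have hxV' : x ∈ conjInfCenter g S 0 := by
      rw [← h.smul_conjInfCenter (h.left_le h.sq_mem), mem_conj_smul]
      exact hxV
    rw [show t * t * ((t * t)⁻¹ * x * (t * t)) * (t * t)⁻¹ = x by group] at key
    rw [hY, ← hZ0, ← hZ1]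
    exact ⟨⟨hxV', centralizer_le (SetLike.coe_subset_coe.2 le_sup_left) key⟩,
      hxV', centralizer_le (SetLike.coe_subset_coe.2 le_sup_right) key⟩
  set Y' := conjCenter g S (-1) ⊓ conjCenter g S 0 with hY'
  have hgY : MulAut.conj g • Y' = Y := by
    rw [hY', smul_inf, hzs, hzs]; rfl
  have htY' : MulAut.conj t • Y' = Y := by
    refine smul_left_cancel (MulAut.conj l) ?_
    rw [← mul_smul, ← map_mul, hYl]
    exact hgY
  have htY : MulAut.conj t • Y = Y' := by
    refine smul_left_cancel (MulAut.conj t) ?_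
    rw [← mul_smul, ← map_mul, htt, htY']
  have hN : Y ⊓ Y' = ⊥ := by
    refine h.core _ ?_ ?_ (by rw [smul_inf, htY, htY', inf_comm])
    · rw [← h.conjInf_one_zero]
      exact inf_le_left.trans (inf_le_left.trans hZ)
    · exact le_normalizer_of_le_centralizer (le_centralizer_comm (inf_le_left.trans hYH))
  have h3 := ((hzs.inf (hzs.add 1)).inf (hzs.add 2))
  have h4 : (⊥ : Subgroup G) = conjCenter g S (-1) ⊓ conjCenter g S (-1 + 1) ⊓
      conjCenter g S (-1 + 2) := by
    rw [← hN, hY, hY']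
    norm_num
    ext x
    simp only [mem_inf]
    tauto
  exact (h3.smul_eq (i := -1) (k := i + 1) (j := i) (by ring)).symm.trans
    (by rw [← h4, smul_bot])

end IsPushingAmalgam

/-! ### Bounding b and the order of S -/

theorem Subgroup.conj_smul_commutator {G : Type*} [Group G] (g : G) (K L : Subgroup G) :
    MulAut.conj g • ⁅K, L⁆ = ⁅MulAut.conj g • K, MulAut.conj g • L⁆ :=
  map_commutator K L (MulAut.conj g).toMonoidHom

theorem Subgroup.le_normalizer_commutator_self {G : Type*} [Group G] (K : Subgroup G) :
    K ≤ normalizer ((⁅K, K⁆ : Subgroup G) : Set G) := by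
  rw [le_normalizer_iff]
  intro k hk x hx
  have h1 := mul_mem (commutator_mem_commutator hk (commutator_le_self K hx)) hx
  rwa [commutatorElement_def, inv_mul_cancel_right] at h1

namespace IsPushingAmalgam

variable {G : Type*} [Group G] {p : ℕ} {S B M : Subgroup G} {l t : G}
theorem conjInf_succ' (g : G) (S : Subgroup G) (n : ℕ) (i : ℤ) :
    conjInf g S (n + 1) (i - 1) = conjInf g S n i ⊓ conjSeq g S (i - 1) := by
  refine le_antisymm (le_inf (conjInf_le_conjInf (by omega) (by push_cast; omega))
    (conjInf_le_conjSeq (by omega) (by push_cast; omega))) ?_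
  rintro x ⟨h1, h2⟩
  refine mem_conjInf.2 fun j h3 h4 => ?_
  by_cases h5 : i ≤ j
  · exact mem_conjInf.1 h1 j h5 (by push_cast at h4; omega)
  · rwa [show j = i - 1 by omega]

variable [Finite G] [hp : Fact p.Prime] {b : ℕ}

theorem IsCritical.relIndex_le (hb : IsCritical (l * t) S b) (h : IsPushingAmalgam p S B M l t)
    (hZ : conjCenter (l * t) S 0 ≤ conjInf (l * t) S 1 0) {K : Subgroup G} {i j : ℤ}
    (hj : j = i ∨ j = i + 1) (hK : K ≤ conjInfCenter (l * t) S i) :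
    (conjCenter (l * t) S j).relIndex K ≤ p := by
  have : (conjCenter (l * t) S j).relIndex (conjInfCenter (l * t) S i) = p := by
    rcases hj with rfl | rfl
    · exact hb.relIndex h hZ j
    · exact hb.relIndex_succ h hZ i
  rw [← this]
  exact relIndex_le_of_le_right hK (by rw [this]; exact hp.out.ne_zero)

/-- Z_i ∩ Z_(i+1) lies in V_(i+1), where Z_(i+2) has index p, and it meets Z_(i+2) trivially. -/
theorem IsCritical.card_inf_le (hb : IsCritical (l * t) S b) (h : IsPushingAmalgam p S B M l t)
    (hZ : conjCenter (l * t) S 0 ≤ conjInf (l * t) S 1 0) (i : ℤ) :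
    Nat.card (conjCenter (l * t) S i ⊓ conjCenter (l * t) S (i + 1) : Subgroup G) ≤ p := by
  have h1 := hb.conjCenter_inf_eq h hZ i
  rw [← relIndex_bot_left, ← h1, inf_relIndex_left]
  exact hb.relIndex_le h hZ (Or.inr (by ring))
    (inf_le_right.trans (conjCenter_le_conjInfCenter hZ (i + 1)))

theorem IsCritical.card_conjCenter_le (hb : IsCritical (l * t) S b)
    (h : IsPushingAmalgam p S B M l t)
    (hZ : conjCenter (l * t) S 0 ≤ conjInf (l * t) S 1 0) (i : ℤ) :
    Nat.card (conjCenter (l * t) S i) ≤ p ^ 2 := by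
  rw [← card_mul_relIndex (K := conjCenter (l * t) S i ⊓ conjCenter (l * t) S (i + 1))
    inf_le_left, inf_relIndex_left, sq]
  exact Nat.mul_le_mul (hb.card_inf_le h hZ i)
    (hb.relIndex_le h hZ (Or.inr rfl) (conjCenter_le_conjInfCenter hZ i))

/-- A nontrivial commutator r of V_0 with V_b lies in Z_1 ∩ Z_b. If b ≥ 3, then V_b lies in S_(b+2)
and S_(b+3), which forces r into Z_2 and then Z_3. -/
theorem IsCritical.le_two (hb : IsCritical (l * t) S b) (h : IsPushingAmalgam p S B M l t)
    (hZ : conjCenter (l * t) S 0 ≤ conjInf (l * t) S 1 0) : b ≤ 2 := by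
  by_contra! h3
  obtain ⟨r, hr1, hr, hrb⟩ := hb.exists_ne_one h 0
  have hs : ∀ j : ℤ, j = b + 2 ∨ j = b + 3 → r ∈ conjSeq (l * t) S j := fun j hj =>
    hb.le_conjSeq b j (by omega) (by omega) (conjCenter_le_conjInfCenter hZ b (by simpa using hrb))
  rw [zero_add] at hr
  have h2 : r ∈ conjCenter (l * t) S (1 + 1) :=
    hb.inf_le_succ h 1 ⟨conjCenter_le_conjInfCenter hZ 1 hr, hs _ (Or.inl (by ring))⟩
  have h3 : r ∈ conjCenter (l * t) S (1 + 1 + 1) :=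
    hb.inf_le_succ h (1 + 1) ⟨conjCenter_le_conjInfCenter hZ _ h2, hs _ (Or.inr (by ring))⟩
  have : r ∈ conjCenter (l * t) S 1 ⊓ conjCenter (l * t) S (1 + 1) ⊓ conjCenter (l * t) S (1 + 2) :=
    ⟨⟨hr, h2⟩, h3⟩
  rw [hb.conjCenter_inf_eq h hZ 1] at this
  exact hr1 this

theorem IsCritical.conjInf_sup_eq (hb : IsCritical (l * t) S b) (h : IsPushingAmalgam p S B M l t)
    {n : ℕ} {i k : ℤ} (h1 : k - b < i) (h2 : i + n = k + b) :
    conjInf (l * t) S (n + 1) i ⊔ conjInfCenter (l * t) S k = conjInf (l * t) S n i := by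
  have := h.inf_conjSeq_sup (K := conjInf (l * t) S n i) (J := conjInfCenter (l * t) S k)
    (i := i + n) (j := i + n + 1) (conjInf_le_conjSeq (by omega) (by omega)) (Or.inl rfl)
    (hb.le_conjInf h1 h2.le) (by rw [h2]; exact hb.not_le k)
  rwa [← conjInf_succ] at this

theorem IsCritical.conjInf_sup_eq' (hb : IsCritical (l * t) S b)
    (h : IsPushingAmalgam p S B M l t) {n : ℕ} {i k : ℤ} (h1 : i + n ≤ k + b) (h2 : i - 1 = k - b) :
    conjInf (l * t) S (n + 1) (i - 1) ⊔ conjInfCenter (l * t) S k = conjInf (l * t) S n i := by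
  have := h.inf_conjSeq_sup (K := conjInf (l * t) S n i) (J := conjInfCenter (l * t) S k)
    (i := i) (j := i - 1) (conjInf_le_conjSeq le_rfl (by omega)) (Or.inr (by ring))
    (hb.le_conjInf (by omega) h1) (by rw [h2]; exact hb.not_le' k)
  rwa [← conjInf_succ'] at this

/-- Let F = S_(-b)..S_b. Both F and its shift gFg⁻¹ generate S_(1-b)..S_b together with V_0, which
is central there. So [F,F] = [gFg⁻¹,gFg⁻¹] is invariant under g; its normaliser contains S by Sims'
lemma, and `core'` makes it trivial. -/
theorem IsCritical.conjInf_le_centralizer_self (hb : IsCritical (l * t) S b)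
    (h : IsPushingAmalgam p S B M l t)
    (hZ : conjCenter (l * t) S 0 ≤ conjInf (l * t) S 1 0) :
    conjInf (l * t) S (2 * b) (-b) ≤ centralizer (conjInf (l * t) S (2 * b) (-b) : Set G) := by
  have hpos := hb.pos
  set g := l * t with hg
  obtain ⟨n, hn⟩ : ∃ n, 2 * b = n + 1 := ⟨2 * b - 1, by omega⟩
  rw [hn]
  set F := conjInf g S (n + 1) (-b) with hF
  have e1 : F ⊔ conjInfCenter g S 0 = conjInf g S n (1 - b) := by
    have := hb.conjInf_sup_eq' h (n := n) (i := 1 - b) (k := 0) (by omega) (by ring)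
    rwa [show (1 - b - 1 : ℤ) = -b by ring] at this
  have e2 : conjInf g S (n + 1) (1 - b) ⊔ conjInfCenter g S 0 = conjInf g S n (1 - b) :=
    hb.conjInf_sup_eq h (by omega) (by omega)
  have hcent : conjInfCenter g S 0 ≤ centralizer (conjInf g S n (1 - b) : Set G) := by
    refine inf_le_right.trans (centralizer_le ?_)
    exact conjInf_le_conjInf (by omega) (by push_cast; omega)
  have h1 : ⁅F, F⁆ = ⁅conjInf g S n (1 - b), conjInf g S n (1 - b)⁆ := by
    rw [← commutator_sup_eq (F := F) (V := conjInfCenter g S 0) (by rwa [e1]), e1]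
  have h2 : ⁅conjInf g S (n + 1) (1 - b), conjInf g S (n + 1) (1 - b)⁆ =
      ⁅conjInf g S n (1 - b), conjInf g S n (1 - b)⁆ := by
    rw [← commutator_sup_eq (V := conjInfCenter g S 0) (by rwa [e2]), e2]
  have hg' : MulAut.conj g • ⁅F, F⁆ = ⁅F, F⁆ := by
    have : MulAut.conj g • F = conjInf g S (n + 1) (1 - b) := by
      rw [hF, isShift_conjInf]; congr 1; ring
    rw [conj_smul_commutator, this, h1, h2]
  have hgJ : g ∈ normalizer ((⁅F, F⁆ : Subgroup G) : Set G) := conj_smul_eq_iff.1 hg'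
  have hK : conjInf g S n 0 ≤ normalizer ((⁅F, F⁆ : Subgroup G) : Set G) := by
    have h3 : conjInf g S n (1 - b) ≤ normalizer ((⁅F, F⁆ : Subgroup G) : Set G) := by
      rw [h1]
      exact le_normalizer_commutator_self _
    have h4 := (conj_smul_eq_iff (g := g ^ (b - 1 : ℤ))).2
      (Subgroup.le_normalizer (zpow_mem hgJ (b - 1 : ℤ)))
    rw [← h4, ← (isShift_conjInf g S n).smul_eq (i := 1 - b) (k := b - 1) (by ring)]
    exact conj_smul_mono _ h3
  have hFS : F ≤ S := (conjInf_le_conjSeq (j := 0) (by omega) (by omega)).trans_eq (conjSeq_zero _ _)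
  have hSF : S ≤ normalizer ((⁅F, F⁆ : Subgroup G) : Set G) := by
    refine h.le_of_conjInf_le hgJ hK fun hbot => h.conjCenter_ne_bot (b - 1 : ℤ) (eq_bot_iff.2 ?_)
    rw [← hbot]
    exact (conjCenter_le_conjInfCenter hZ _).trans (hb.le_conjInf (by omega) (by omega))
  have hFF : ⁅F, F⁆ ≤ F := commutator_le_self F
  exact commutator_eq_bot_iff_le_centralizer.1 (h.core' (hFF.trans hFS) hSF hg')

/-- F = S_(-b)..S_b centralises itself and is centralised by V_k for -b ≤ k < b, since F ≤ Q_k.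
Adding V_(j-b) and V_(b-1-j) to S_(-j-1)..S_(j+1) gives S_(-j)..S_j; descending to j = 0, all of S
centralises F. -/
theorem IsCritical.conjInf_le_conjCenter (hb : IsCritical (l * t) S b)
    (h : IsPushingAmalgam p S B M l t)
    (hZ : conjCenter (l * t) S 0 ≤ conjInf (l * t) S 1 0) :
    conjInf (l * t) S (2 * b) (-b) ≤ conjCenter (l * t) S 0 := by
  set g := l * t with hg
  set F := conjInf g S (2 * b) (-b) with hF
  have hV : ∀ k : ℤ, -b ≤ k → k < b → conjInfCenter g S k ≤ centralizer (F : Set G) :=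
    fun k h1 h2 => inf_le_right.trans (centralizer_le
      (conjInf_le_conjInf (by omega) (by push_cast; omega)))
  have key : ∀ m ≤ b, ∀ j : ℕ, j + m = b → conjInf g S (2 * j) (-j) ≤ centralizer (F : Set G) := by
    intro m
    induction m with
    | zero =>
      rintro - j rfl
      exact hb.conjInf_le_centralizer_self h hZ
    | succ m ih =>
      intro hm j hj
      have h1 := ih (by omega) (j + 1) (by omega)
      rw [show 2 * (j + 1) = 2 * j + 1 + 1 by ring,
        show (-(j + 1 : ℕ) : ℤ) = -j - 1 by push_cast; ring] at h1
      rw [← hb.conjInf_sup_eq h (n := 2 * j) (i := -j) (k := j - b) (by omega)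
          (by push_cast; ring),
        ← hb.conjInf_sup_eq' h (n := 2 * j + 1) (i := -j) (k := b - 1 - j)
          (by push_cast; omega) (by ring)]
      exact sup_le (sup_le h1 (hV _ (by omega) (by omega))) (hV _ (by omega) (by omega))
  have h0 := key b le_rfl 0 (by omega)
  rw [mul_zero, Nat.cast_zero, neg_zero, conjInf_zero] at h0
  exact le_inf (conjInf_le_conjSeq (by omega) (by omega)) (le_centralizer_comm h0)

theorem IsCritical.card_le (hb : IsCritical (l * t) S b)
    (h : IsPushingAmalgam p S B M l t)
    (hZ : conjCenter (l * t) S 0 ≤ conjInf (l * t) S 1 0) : Nat.card S ≤ p ^ (2 * b + 2) := by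
  refine (h.card_le_pow_mul (2 * b) (-b)).trans ?_
  rw [pow_add]
  exact Nat.mul_le_mul_left _ ((Subgroup.card_le_of_le (hb.conjInf_le_conjCenter h hZ)).trans
    (hb.card_conjCenter_le h hZ 0))

/-- S_(-1)..S_2 is generated by S_(-2)..S_2 ≤ Z_0 ≤ V_0 together with V_0. -/
theorem IsCritical.conjInf_eq_conjInfCenter (hb : IsCritical (l * t) S 2)
    (h : IsPushingAmalgam p S B M l t)
    (hZ : conjCenter (l * t) S 0 ≤ conjInf (l * t) S 1 0) (i : ℤ) :
    conjInf (l * t) S 3 i = conjInfCenter (l * t) S (i + 1) := by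
  have h0 : conjInf (l * t) S 3 (-1) = conjInfCenter (l * t) S 0 := by
    rw [← hb.conjInf_sup_eq' h (n := 3) (i := -1) (k := 0) (by simp) (by simp)]
    exact sup_eq_right.2 ((hb.conjInf_le_conjCenter h hZ).trans (conjCenter_le_conjInfCenter hZ 0))
  exact (isShift_conjInf _ S 3).eq (isShift_conjInfCenter _ S) h0 (by ring)

/-- Exponent 2 climbs through commuting products: Z_i ∩ Z_(i+1) has order at most 2, Z_i is
generated by two such groups, V_i by Z_i and Z_(i+1), and S_i..S_(i+2) by V_i and V_(i+1). -/
theorem IsCritical.sq_eq_one (hb : IsCritical (l * t) S 2)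
    (h : IsPushingAmalgam 2 S B M l t)
    (hZ : conjCenter (l * t) S 0 ≤ conjInf (l * t) S 1 0) {i : ℤ} {x : G}
    (hx : x ∈ conjInf (l * t) S 2 i) : x ^ 2 = 1 := by
  have hp : Fact (Nat.Prime 2) := ⟨Nat.prime_two⟩
  set g := l * t with hg
  have hY : ∀ i, ∀ x ∈ conjCenter g S i ⊓ conjCenter g S (i + 1), x ^ 2 = 1 := by
    intro i x hx
    have h1 := hb.card_inf_le h hZ i
    have h2 := _root_.orderOf_le_card (x := (⟨x, hx⟩ : (conjCenter g S i ⊓ conjCenter g S (i + 1) :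
      Subgroup G)))
    rw [← orderOf_coe] at h2
    have h3 := orderOf_pos x
    exact orderOf_dvd_iff_pow_eq_one.1 (by
      have : orderOf x ≤ 2 := h2.trans h1
      interval_cases orderOf x <;> decide)
  have hZsq : ∀ i, ∀ x ∈ conjCenter g S i, x ^ 2 = 1 := by
    intro i x hx
    obtain ⟨r, hr1, hr⟩ := hb.exists_ne_one h (i - 2)
    rw [show i - 2 + 1 = i - 1 by ring, show i - 2 + (2 : ℕ) = i by simp] at hr
    have hrel : ((conjCenter g S i ⊓ conjCenter g S (i + 1)).relIndex (conjCenter g S i)) = 2 := by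
      rw [inf_relIndex_left]
      refine relIndex_eq_prime_of_le ((h.isPGroup_conjSeq i).to_le inf_le_left)
        (hb.relIndex_le h hZ (Or.inr rfl) (conjCenter_le_conjInfCenter hZ i)) fun hle => ?_
      exact h.conjCenter_ne_succ i
        (eq_of_le_of_card_ge hle ((isShift_conjCenter g S).card _ _).le)
    have hi : i - 1 + 1 = i := by ring
    have hsup := sup_eq_of_relIndex_prime
      (K := conjCenter g S i ⊓ conjCenter g S (i + 1)) (A := conjCenter g S i)
      (J := conjCenter g S (i - 1) ⊓ conjCenter g S i) inf_le_left inf_le_right (fun hle => by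
        have h1 := hb.conjCenter_inf_eq h hZ (i - 1)
        rw [hi, show i - 1 + 2 = i + 1 by ring] at h1
        have h2 : r ∈ (⊥ : Subgroup G) := h1 ▸ ⟨hr, (hle hr).2⟩
        exact hr1 h2) (by rw [hrel]; exact Nat.prime_two)
    rw [← hsup] at hx
    refine sq_eq_one_of_mem_sup ?_ (hY i) (fun y hy => hY (i - 1) y (by rwa [hi])) hx
    exact inf_le_left.trans (inf_le_right.trans (centralizer_le (inf_le_right.trans inf_le_left)))
  have hVsq : ∀ i, ∀ x ∈ conjInfCenter g S i, x ^ 2 = 1 := by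
    intro i x hx
    have hsup := sup_eq_of_relIndex_prime (conjCenter_le_conjInfCenter hZ i)
      (h.conjCenter_succ_le_conjInfCenter hZ i) (fun hle => h.conjCenter_ne_succ i
        (eq_of_le_of_card_ge hle ((isShift_conjCenter g S).card _ _).le).symm)
      (by rw [hb.relIndex h hZ]; exact Nat.prime_two)
    rw [← hsup] at hx
    refine sq_eq_one_of_mem_sup ?_ (hZsq i) (hZsq (i + 1)) hx
    exact (conjCenter_le_conjInfCenter hZ i).trans ((conjInfCenter_le_centralizer_self g S i).trans
      (centralizer_le (h.conjCenter_succ_le_conjInfCenter hZ i)))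
  have hsup := hb.conjInf_sup_eq h (n := 2) (i := i) (k := i) (by simp) rfl
  rw [hb.conjInf_eq_conjInfCenter h hZ] at hsup
  rw [← hsup] at hx
  exact sq_eq_one_of_mem_sup (hb.le_centralizer (by omega) (by omega)) (hVsq _) (hVsq _) hx

/-- Let D = S_(-1)..S_1 and D_0 = S_0..S_2 = lDl⁻¹. If S normalised D_0, then l would too, giving D
= D_0, a nontrivial shift-invariant intersection. Otherwise s ∈ S moves some d ∈ D_0 out of D_0; but
w = [s,d] turns out to centralise Q_0, so w ∈ V_0 ≤ D_0 and sds⁻¹ = wd ∈ D_0. -/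
theorem not_isCritical_two (h : IsPushingAmalgam 2 S B M l t)
    (hZ : conjCenter (l * t) S 0 ≤ conjInf (l * t) S 1 0) : ¬ IsCritical (l * t) S 2 := by
  intro hb
  have hp : Fact (Nat.Prime 2) := ⟨Nat.prime_two⟩
  set g := l * t with hg
  have hsq : ∀ i, ∀ x ∈ conjInf g S 2 i, x ^ 2 = 1 := fun i x hx => hb.sq_eq_one h hZ hx
  have hD : conjInf g S 2 (-1) = conjInf g S 1 0 ⊓ conjInf g S 1 (-1) :=
    le_antisymm (le_inf (conjInf_le_conjInf (by omega) (by simp))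
      (conjInf_le_conjInf (by omega) (by simp))) fun x hx => mem_conjInf.2 fun j h1 h2 => by
        by_cases h3 : 0 ≤ j
        · exact mem_conjInf.1 hx.1 j h3 (by push_cast at h2 ⊢; omega)
        · exact mem_conjInf.1 hx.2 j h1 (by push_cast; omega)
  have hSD : S ≤ normalizer (conjInf g S 2 (-1) : Set G) := by
    rw [hD]
    exact le_normalizer_inf ((le_sup_left.trans h.sup_le_ambient).trans
      h.le_normalizer_conjInf_zero) h.le_normalizer_conjInf_pred
  have hgD : MulAut.conj g • conjInf g S 2 (-1) = conjInf g S 2 0 := isShift_conjInf g S 2 (-1)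
  have hlD : MulAut.conj l • conjInf g S 2 (-1) = conjInf g S 2 0 := by
    rw [← hgD, map_mul, mul_smul, hD, smul_inf (MulAut.conj t), h.smul_conjInf_pred,
      h.smul_conjInf_zero, inf_comm]
  have hsD : MulAut.conj l • S ≤ normalizer (conjInf g S 2 0 : Set G) := by
    rw [← hlD]; exact le_normalizer_conj_smul hSD
  by_cases hcase : S ≤ normalizer (conjInf g S 2 0 : Set G)
  · have h1 := conj_smul_eq_iff.2 (sup_le hcase hsD h.mem_sup)
    have h2 : conjInf g S 2 (-1) = conjInf g S 2 0 := smul_left_cancel _ (hlD.trans h1.symm)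
    have h3 := h.conjInf_eq_bot_of_invariant 2 (by rw [← h2, hgD, h2])
    refine h.conjCenter_ne_bot 1 (eq_bot_iff.2 ?_)
    rw [← h3]
    exact (conjCenter_le_conjInfCenter hZ _).trans (hb.le_conjInf (by norm_num) (by norm_num))
  rw [le_normalizer_iff] at hcase
  push Not at hcase
  obtain ⟨s, hs, d, hd, hsd⟩ := hcase
  set w := s * d * s⁻¹ * d⁻¹ with hw
  have hwd : w * d = s * d * s⁻¹ := by rw [hw]; group
  have hsQ : ∀ x ∈ conjInf g S 1 0, s * x * s⁻¹ ∈ conjInf g S 1 0 := fun x hx =>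
    (mem_normalizer_iff.1 (h.le_normalizer_conjInf_zero
      (le_sup_left.trans h.sup_le_ambient hs)) x).1 hx
  have hDQ : conjInf g S 2 (-1) ≤ conjInf g S 1 0 := conjInf_le_conjInf (by omega) (by simp)
  have hD₁Q : conjInf g S 2 0 ≤ conjInf g S 1 0 := conjInf_le_conjInf (by omega) (by simp)
  have hQs : conjInf g S 1 0 ⊓ conjSeq g S (-1) = conjInf g S 2 (-1) := by
    have := conjInf_succ' g S 1 0
    rw [zero_sub] at this
    exact this.symm
  have hD₁s : conjInf g S 2 0 ⊓ conjSeq g S (-1) = conjInfCenter g S 0 := by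
    have := conjInf_succ' g S 2 0
    rw [zero_sub] at this
    rw [← this, hb.conjInf_eq_conjInfCenter h hZ, neg_add_cancel]
  have hVD₁ : conjInfCenter g S 0 ≤ conjInf g S 2 0 := hD₁s ▸ inf_le_left
  have hQS : conjInf g S 1 0 ≤ conjSeq g S 0 := conjInf_le_conjSeq le_rfl (by simp)
  have hdV : d ∉ conjSeq g S (-1) := fun hdV => hsd <| by
    have h1 : d ∈ conjInfCenter g S 0 := hD₁s ▸ ⟨hd, hdV⟩
    exact hVD₁ ((mem_normalizer_iff.1 (h.le_normalizer_conjInfCenter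
      (le_sup_left.trans h.sup_le_ambient hs)) d).1 h1)
  have hsdQ := hsQ d (hD₁Q hd)
  -- D has index 2 in Q_0, and neither d nor sds⁻¹ lies in D.
  have hwD : w ∈ conjInf g S 2 (-1) := by
    have h1 : s * d * s⁻¹ ∉ conjInf g S 2 (-1) := fun h1 => hdV <| by
      have := (mem_normalizer_iff.1 (hSD hs) d).2 h1
      rw [← hQs] at this
      exact this.2
    have h2 : (conjInf g S 2 (-1)).relIndex (conjInf g S 1 0) = 2 := by
      rw [← hQs, inf_relIndex_left]
      exact h.relIndex_eq_of_not_le_conjSeq hQS (Or.inr (by ring)) fun hle => hdV (hle (hD₁Q hd))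
    have h3 := mul_mem_iff_of_index_two h2 (a := ⟨_, hsdQ⟩) (b := (⟨d, hD₁Q hd⟩ : _)⁻¹)
    rw [mem_subgroupOf, mem_subgroupOf, mem_subgroupOf] at h3
    refine h3.2 (iff_of_false h1 fun h4 => hdV ?_)
    have h5 := inv_mem h4
    rw [← hQs] at h5
    simpa using h5.2
  -- w, d and wd = sds⁻¹ all square to 1.
  have hwd_comm : Commute w d := by
    have h1 : w * w = 1 := by rw [← sq]; exact hsq _ _ hwD
    have h2 : d * d = 1 := by rw [← sq]; exact hsq _ _ hd
    have h3 : w * d * (w * d) = 1 := by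
      rw [hwd, show s * d * s⁻¹ * (s * d * s⁻¹) = s * (d * d) * s⁻¹ by group, h2]
      group
    have h4 : w⁻¹ = w := inv_eq_of_mul_eq_one_left h1
    have h5 : d⁻¹ = d := inv_eq_of_mul_eq_one_left h2
    have h6 := eq_inv_of_mul_eq_one_left h3
    rwa [mul_inv_rev, h4, h5] at h6
  have hDw : conjInf g S 2 (-1) ≤ centralizer {w} := by
    intro x hx
    rw [mem_centralizer_singleton_iff]
    have h1 := hsq _ _ hx
    have h2 := hsq _ _ hwD
    have h3 := hsq _ _ (mul_mem hx hwD)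
    rw [sq] at h1 h2 h3
    have h6 := eq_inv_of_mul_eq_one_left h3
    rwa [mul_inv_rev, inv_eq_of_mul_eq_one_left h1, inv_eq_of_mul_eq_one_left h2] at h6
  have hD₁w : conjInf g S 2 0 ≤ centralizer {w} := by
    rw [← h.inf_conjSeq_sup (K := conjInf g S 2 0) (J := zpowers d) (i := 0) (j := -1)
      (hD₁Q.trans hQS) (Or.inr (by ring)) ((zpowers_le).2 hd)
      fun hle => hdV (hle (mem_zpowers d))]
    refine sup_le (le_trans ?_ hDw) ((zpowers_le).2 ?_)
    · rw [← hQs]; exact inf_le_inf_right _ hD₁Q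
    · rw [mem_centralizer_singleton_iff]
      exact hwd_comm.eq.symm
  have hQw : conjInf g S 1 0 ≤ centralizer {w} := by
    rw [← h.inf_conjSeq_sup (K := conjInf g S 1 0) (J := conjInf g S 2 0) (i := 0) (j := -1)
      hQS (Or.inr (by ring)) hD₁Q fun hle => hdV (hle hd), hQs]
    exact sup_le hDw hD₁w
  have hwV : w ∈ conjInfCenter g S 0 := by
    refine ⟨hDQ hwD, mem_centralizer_iff.2 fun x hx => ?_⟩
    exact mem_centralizer_singleton_iff.1 (hQw hx)
  apply hsd
  rw [← hwd]
  exact mul_mem (hVD₁ hwV) hd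

theorem card_le_pow_six (h : IsPushingAmalgam p S B M l t) : Nat.card S ≤ p ^ 6 := by
  by_cases hZ : conjCenter (l * t) S 0 ≤ conjInf (l * t) S 1 0
  · obtain ⟨b, hb⟩ := h.exists_isCritical hZ
    refine (hb.card_le h hZ).trans (Nat.pow_le_pow_right hp.out.pos ?_)
    have := hb.le_two h hZ
    omega
  · exact (h.card_le_of_not_conjCenter_le hZ).trans (Nat.pow_le_pow_right hp.out.pos (by norm_num))

theorem card_le_sixteen (h : IsPushingAmalgam 2 S B M l t) : Nat.card S ≤ 16 := by
  have hp : Fact (Nat.Prime 2) := ⟨Nat.prime_two⟩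
  by_cases hZ : conjCenter (l * t) S 0 ≤ conjInf (l * t) S 1 0
  · obtain ⟨b, hb⟩ := h.exists_isCritical hZ
    have h2 := hb.le_two h hZ
    have h3 : b ≠ 2 := by
      rintro rfl
      exact h.not_isCritical_two hZ hb
    refine (hb.card_le h hZ).trans ?_
    rw [show 16 = 2 ^ 4 by norm_num]
    exact Nat.pow_le_pow_right two_pos (by omega)
  · exact (h.card_le_of_not_conjCenter_le hZ).trans (by norm_num)

end IsPushingAmalgam

/-! ### Sylow subgroups and the construction of the amalgam -/

section SylowIn

variable {G : Type*} [Group G] {p : ℕ}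

/-- `S` is a Sylow `p`-subgroup of `J`, both being subgroups of an ambient finite group. -/
structure IsSylowIn (p : ℕ) (S J : Subgroup G) : Prop where
  le : S ≤ J
  isPGroup : IsPGroup p S
  not_dvd : ¬ p ∣ S.relIndex J

namespace IsSylowIn

theorem of_sylow [Finite G] [Fact p.Prime] {J : Subgroup G} (P : Sylow p J) :
    IsSylowIn p ((P : Subgroup J).map J.subtype) J where
  le := map_subtype_le _
  isPGroup := P.2.map _
  not_dvd := by
    change ¬ p ∣ (((P : Subgroup J).map J.subtype).subgroupOf J).index
    rw [subgroupOf, comap_map_eq_self_of_injective J.subtype_injective]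
    exact P.not_dvd_index

variable {S T J : Subgroup G}

theorem mono (h : IsSylowIn p S J) {J' : Subgroup G} (h1 : S ≤ J') (h2 : J' ≤ J) :
    IsSylowIn p S J' :=
  ⟨h1, h.isPGroup, fun hd => h.not_dvd
    (hd.trans ⟨_, (relIndex_mul_relIndex _ _ _ h1 h2).symm⟩)⟩

theorem conj (h : IsSylowIn p S J) (g : G) :
    IsSylowIn p (MulAut.conj g • S) (MulAut.conj g • J) where
  le := conj_smul_mono g h.le
  isPGroup := h.isPGroup.map _
  not_dvd := by rw [relIndex_conj_smul]; exact h.not_dvd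

theorem exists_conj_eq [Finite G] [Fact p.Prime] (hS : IsSylowIn p S J) (hT : IsSylowIn p T J) :
    ∃ g ∈ J, MulAut.conj g • S = T := by
  let S' : Sylow p J := (hS.isPGroup.comap_subtype (K := J)).toSylow hS.not_dvd
  let T' : Sylow p J := (hT.isPGroup.comap_subtype (K := J)).toSylow hT.not_dvd
  obtain ⟨g, hg⟩ := MulAction.exists_smul_eq J S' T'
  refine ⟨g, g.2, ?_⟩
  have h : MulAut.conj g • S.subgroupOf J = T.subgroupOf J := congrArg Sylow.toSubgroup hg
  have h2 := congrArg (map J.subtype) h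
  rw [map_conj_smul, subgroupOf_map_subtype, subgroupOf_map_subtype, inf_of_le_left hS.le,
    inf_of_le_left hT.le] at h2
  exact h2

theorem card_eq [Finite G] [Fact p.Prime] (h : IsSylowIn p S J) :
    Nat.card S = p ^ (Nat.card J).factorization p := by
  rw [← ((h.isPGroup.comap_subtype (K := J)).toSylow h.not_dvd).card_eq_multiplicity]
  exact Nat.card_congr (subgroupOfEquivOfLe h.le).symm.toEquiv

/-- |K : S ∩ K| = |SK : S|, and S is Sylow in SK. -/
theorem inf_of_le_normalizer [Finite G] (h : IsSylowIn p S J) {K : Subgroup G} (hK : K ≤ J)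
    (hJK : J ≤ normalizer (K : Set G)) : IsSylowIn p (S ⊓ K) K where
  le := inf_le_right
  isPGroup := h.isPGroup.to_le inf_le_left
  not_dvd := by
    have hn : (K.subgroupOf J).Normal := (normal_subgroupOf_iff_le_normalizer hK).2 hJK
    have h1 : (S ⊓ K).relIndex K = S.relIndex (S ⊔ K) := by
      rw [← relIndex_subgroupOf (sup_le h.le hK), subgroupOf_sup h.le hK]
      have e1 := relIndex_sup_right (S.subgroupOf J) (K.subgroupOf J)
      have e2 := card_mul_relIndex (le_sup_left : S.subgroupOf J ≤ S.subgroupOf J ⊔ K.subgroupOf J)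
      have e3 := card_mul_relIndex (le_sup_right : K.subgroupOf J ≤ S.subgroupOf J ⊔ K.subgroupOf J)
      have e4 := card_mul_relIndex (inf_le_left : S.subgroupOf J ⊓ K.subgroupOf J ≤ S.subgroupOf J)
      have e5 := card_mul_relIndex (inf_le_right : S.subgroupOf J ⊓ K.subgroupOf J ≤ K.subgroupOf J)
      rw [inf_relIndex_left] at e4
      rw [inf_relIndex_right, relIndex_subgroupOf hK] at e5
      rw [e1, ← e5, ← e2, ← e4] at e3
      rw [inf_relIndex_right]
      have hS0 : 0 < Nat.card (S.subgroupOf J ⊓ K.subgroupOf J : Subgroup J) *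
          (K.subgroupOf J).relIndex (S.subgroupOf J) := by rw [e4]; exact Nat.card_pos
      refine Nat.eq_of_mul_eq_mul_left hS0 ?_
      rw [← e3]
      ring
    rw [h1]
    exact (h.mono le_sup_left (sup_le h.le hK)).not_dvd

end IsSylowIn

end SylowIn

/-- Sylow conjugacy in K, in a conjugate of B and in B lets l and t be replaced so that l ∈ H and t
normalises S. Intersecting A and B with the normaliser of S ∩ K then gives M and the new B. -/
theorem exists_isPushingAmalgam {G : Type*} [Group G] [Finite G] {p : ℕ} [hp : Fact p.Prime]
    {A B K S : Subgroup G} {l t : G} (hBA : B ≤ A) (hKB : K ≤ B)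
    (hAK : A ≤ normalizer (K : Set G)) (hAB : ¬ A ≤ B) (hS : IsSylowIn p S B)
    (hSK : K.relIndex S = p) (hl : l ∈ A)
    (hfac : ∀ a ∈ A, ∃ h ∈ S ⊔ MulAut.conj l • S, ∃ b ∈ B, a = h * b)
    (ht : MulAut.conj t • B = B) (ht2 : t * t ∈ B)
    (hcore : ∀ N ≤ B, ∀ b ∈ B, (∀ a ∈ A, ∃ h ∈ normalizer (N : Set G), ∃ c ∈ B, a = h * c) →
      b * t ∈ normalizer (N : Set G) → N = ⊥) :
    ∃ B' M l' t', IsPushingAmalgam p S B' M l' t' := by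
  have hSA : S ≤ A := hS.le.trans hBA
  have hconjA : ∀ {a : G}, a ∈ A → ∀ {C : Subgroup G}, C ≤ A → MulAut.conj a • C ≤ A :=
    fun {a} ha C hC => (conj_smul_mono a hC).trans
      (conj_smul_eq_iff.2 (le_normalizer ha)).le
  have hQ : IsSylowIn p (S ⊓ K) K := hS.inf_of_le_normalizer hKB (hBA.trans hAK)
  -- `l` may be adjusted by `K` so as to normalise `S ∩ K`
  obtain ⟨k, hk, hkQ⟩ := IsSylowIn.exists_conj_eq
    (conj_smul_eq_iff.2 (hAK hl) ▸ hQ.conj l) hQ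
  rw [← mul_smul, ← map_mul] at hkQ
  set l₁ := k * l with hl₁
  have hl₁A : l₁ ∈ A := mul_mem (hBA (hKB hk)) hl
  set S₁ := MulAut.conj l₁ • S with hS₁
  set H := S ⊔ S₁ with hH
  have hHA : H ≤ A := sup_le hSA (hconjA hl₁A hSA)
  have hfac' : ∀ a ∈ A, ∃ h ∈ H, ∃ b ∈ B, a = h * b := by
    intro a ha
    obtain ⟨h, hh, b, hb, rfl⟩ := hfac a ha
    have hle : S ⊔ MulAut.conj l • S ≤ H ⊔ K := by
      refine sup_le (le_sup_left.trans le_sup_left) fun x hx => ?_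
      have h1 : k * x * k⁻¹ ∈ H := by
        refine mem_sup_right ?_
        rw [hS₁, hl₁, map_mul, mul_smul]
        exact conj_mem_conj_smul hx
      have h2 := mul_mem (mul_mem (mem_sup_right (inv_mem hk) : k⁻¹ ∈ H ⊔ K)
        (mem_sup_left h1)) (mem_sup_right hk)
      simpa [mul_assoc] using h2
    have h1 : h ∈ ((H ⊔ K : Subgroup G) : Set G) := hle hh
    rw [coe_mul_of_left_le_normalizer_right _ _ (hHA.trans hAK)] at h1
    obtain ⟨y, hy, z, hz, rfl⟩ := h1
    exact ⟨y, hy, z * b, mul_mem (hKB hz) hb, mul_assoc _ _ _⟩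
  -- Otherwise H = S ≤ B and A = HB = B.
  have hne : ¬ S ≤ S₁ := by
    intro hle
    have he : S = S₁ := eq_of_le_of_card_ge hle (card_conj_smul _ _).le
    refine hAB fun a ha => ?_
    obtain ⟨h, hh, b, hb, rfl⟩ := hfac' a ha
    rw [hH, ← he, sup_idem] at hh
    exact mul_mem (hS.le hh) hb
  have hQS : S ⊓ S₁ = S ⊓ K := by
    refine (eq_or_eq_of_relIndex_prime (le_inf inf_le_left ?_) inf_le_left ?_).resolve_right
      fun e => hne (inf_eq_left.1 e)
    · rw [← hkQ]
      exact conj_smul_mono _ inf_le_left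
    · rw [inf_relIndex_left, hSK]
      exact hp.out
  have hSQ : S ≤ normalizer ((S ⊓ K : Subgroup G) : Set G) :=
    le_normalizer_inf le_normalizer (hSA.trans hAK)
  have hHQ : H ≤ normalizer ((S ⊓ K : Subgroup G) : Set G) := by
    refine sup_le hSQ ?_
    have := le_normalizer_conj_smul (g := l₁) hSQ
    rwa [hkQ] at this
  -- `l` may be chosen in `H`
  obtain ⟨l₂, hl₂H, hl₂⟩ : ∃ l₂ ∈ H, MulAut.conj l₂ • S = S₁ := by
    -- Writing l₁ = hb, both hSh⁻¹ and S₁ are Sylow in hBh⁻¹ and lie in H, so they are conjugate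
    -- within H.
    obtain ⟨h, hh, b, hb, e⟩ := hfac' l₁ hl₁A
    have h1 : IsSylowIn p (MulAut.conj h • S) (MulAut.conj h • B) := hS.conj h
    have h2 : IsSylowIn p S₁ (MulAut.conj h • B) := by
      have := (hS.conj b).conj h
      rwa [conj_smul_eq_iff.2 (le_normalizer hb), ← mul_smul, ← map_mul, ← e] at this
    have h3 : MulAut.conj h • S ≤ H :=
      (conj_smul_mono h le_sup_left).trans (conj_smul_eq_iff.2 (le_normalizer hh)).le
    obtain ⟨c, hc, he⟩ := (h1.mono (le_inf h1.le h3) inf_le_left).exists_conj_eq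
      (h2.mono (le_inf h2.le le_sup_right) inf_le_left)
    exact ⟨c * h, mul_mem hc.2 hh, by rw [map_mul, mul_smul, he]⟩
  obtain ⟨b, hb, hbS⟩ := IsSylowIn.exists_conj_eq (ht ▸ hS.conj t) hS
  rw [← mul_smul, ← map_mul] at hbS
  have htB : ∀ x ∈ B, t * x * t⁻¹ ∈ B := fun x hx => by
    have := conj_mem_conj_smul (e := t) hx
    rwa [ht] at this
  have hbt : b * t * (b * t) ∈ B := by
    have := mul_mem (mul_mem hb (htB b hb)) ht2
    simpa [mul_assoc] using this
  refine ⟨B ⊓ normalizer ((S ⊓ K : Subgroup G) : Set G),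
    A ⊓ normalizer ((S ⊓ K : Subgroup G) : Set G), l₂, b * t, ?_⟩
  exact
    { isPGroup := hS.isPGroup
      relIndex_eq := by
        rw [hl₂, ← inf_relIndex_left, hQS, inf_relIndex_left, hSK]
      mem_sup := by rwa [hl₂]
      smul_eq := hbS
      sup_le_ambient := by
        rw [hl₂]
        exact le_inf hHA hHQ
      ambient_le_normalizer := by
        rw [hl₂, hQS]
        exact inf_le_right
      le_left := le_inf hS.le hSQ
      left_le := inf_le_inf_right _ hBA
      not_dvd := (hS.mono (le_inf hS.le hSQ) inf_le_left).not_dvd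
      factor := by
        rintro m ⟨hmA, hmN⟩
        obtain ⟨h, hh, c, hc, rfl⟩ := hfac' m hmA
        refine ⟨h, by rwa [hl₂], c, ⟨hc, ?_⟩, rfl⟩
        have := mul_mem (inv_mem (hHQ hh)) hmN
        simpa using this
      sq_mem := by
        have h1 : b * t * (b * t) ∈ normalizer (S : Set G) := by
          have : b * t ∈ normalizer (S : Set G) := conj_smul_eq_iff.1 hbS
          exact mul_mem this this
        exact ⟨hbt, inf_normalizer_le_normalizer_inf ⟨h1, hAK (hBA hbt)⟩⟩
      core := by
        intro N hN hHN htN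
        rw [hl₂] at hHN
        refine hcore N (hN.trans (inf_le_left.trans hS.le)) b hb (fun a ha => ?_)
          (conj_smul_eq_iff.1 htN)
        obtain ⟨h, hh, c, hc, e⟩ := hfac' a ha
        exact ⟨h, hHN hh, c, hc, e⟩ }

/-! ### From locally-L pairs to amalgams -/

namespace LocalAction

variable {Ω : Type u} {V : Type v} {Γ : SimpleGraph V} {G : Subgroup (Γ ≃g Γ)}

/-- The action of `G_v` on `Γ(v)`, transported to `Ω` along a bijection `Ω ≃ Γ(v)`. -/
def localHom (G : Subgroup (Γ ≃g Γ)) {v : V} (e : Ω ≃ Γ.neighborSet v) :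
    MulAction.stabilizer G v →* Equiv.Perm Ω :=
  e.symm.permCongrHom.toMonoidHom.comp (nbhdPermHom Γ G v)

theorem localHom_apply {v : V} (e : Ω ≃ Γ.neighborSet v) (a : MulAction.stabilizer G v) (ω : Ω) :
    (e (localHom G e a ω) : V) = (a : G) • (e ω : V) := by
  have : localHom G e a ω = e.symm (nbhdPermHom Γ G v a (e ω)) := rfl
  rw [this, Equiv.apply_symm_apply]
  rfl

theorem range_localHom {v : V} {L : Subgroup (Equiv.Perm Ω)} (e : Ω ≃ Γ.neighborSet v)
    (h : L.map e.permCongrHom.toMonoidHom = localGroup Γ G v) : (localHom G e).range = L := by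
  rw [localHom, MonoidHom.range_comp]
  change map _ (localGroup Γ G v) = L
  rw [← h, map_map]
  convert map_id L using 2
  ext σ ω
  simp [Equiv.permCongrHom]

theorem adj_smul (g : G) {x y : V} : Γ.Adj (g • x) (g • y) ↔ Γ.Adj x y :=
  (g : Γ ≃g Γ).map_adj_iff

section Arc

variable {L : Subgroup (Equiv.Perm Ω)} {v : V} {e : Ω ≃ Γ.neighborSet v}

theorem exists_smul_eq_of_adj (hL : MulAction.IsPretransitive L Ω)
    (he : (localHom G e).range = L) (ω : Ω) {y : V} (hy : Γ.Adj v y) :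
    ∃ g : G, g • v = v ∧ g • y = e ω := by
  obtain ⟨σ, hσ⟩ := hL.exists_smul_eq (e.symm ⟨y, hy⟩) ω
  obtain ⟨a, ha⟩ : (σ : Equiv.Perm Ω) ∈ (localHom G e).range := he ▸ σ.2
  refine ⟨a, a.2, ?_⟩
  have := localHom_apply e a (e.symm ⟨y, hy⟩)
  rw [ha, Equiv.apply_symm_apply] at this
  rw [← this, ← hσ]
  rfl

theorem exists_smul_arc_eq (hG : MulAction.IsPretransitive G V)
    (hL : MulAction.IsPretransitive L Ω) (he : (localHom G e).range = L) (ω : Ω) {x y : V}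
    (h : Γ.Adj x y) : ∃ g : G, g • x = v ∧ g • y = e ω := by
  obtain ⟨g, rfl⟩ := hG.exists_smul_eq x v
  obtain ⟨a, ha, ha'⟩ := exists_smul_eq_of_adj hL he ω ((adj_smul g).2 h)
  exact ⟨a * g, by rw [mul_smul, ha], by rw [mul_smul, ha']⟩

theorem stabilizer_smul (g : G) (x : V) :
    MulAction.stabilizer G (g • x) = MulAut.conj g • MulAction.stabilizer G x :=
  MulAction.stabilizer_smul_eq_stabilizer_map_conj g x

theorem arcStabilizer_smul (g : G) (x y : V) :
    arcStabilizer Γ G (g • x) (g • y) = MulAut.conj g • arcStabilizer Γ G x y := by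
  rw [arcStabilizer, arcStabilizer, smul_inf, stabilizer_smul, stabilizer_smul]

theorem arcStabilizer_comm (x y : V) : arcStabilizer Γ G x y = arcStabilizer Γ G y x :=
  inf_comm _ _

/-- A subgroup of `G_{vu}` is trivial if its normaliser contains an element reversing the arc
`(v, u)` and is transitive on the neighbours of `v`. -/
theorem eq_bot_of_le_arcStabilizer (hΓ : Γ.Connected) (hL : MulAction.IsPretransitive L Ω)
    (he : (localHom G e).range = L) {ω : Ω} {N : Subgroup G}
    (hN : N ≤ arcStabilizer Γ G v (e ω))
    (hA : ∀ a ∈ MulAction.stabilizer G v, ∃ h ∈ normalizer (N : Set G),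
      ∃ c ∈ arcStabilizer Γ G v (e ω), a = h * c)
    {t : G} (ht : t • v = e ω) (htN : t ∈ normalizer (N : Set G)) : N = ⊥ := by
  have key : ∀ w, ∃ j ∈ normalizer (N : Set G), j • v = w := by
    intro w
    have hvw := (SimpleGraph.reachable_iff_reflTransGen _ _).1 (hΓ.preconnected v w)
    induction hvw with
    | refl => exact ⟨1, one_mem _, one_smul _ _⟩
    | @tail w' w _ hww' ih =>
      obtain ⟨j, hj, rfl⟩ := ih
      have h1 : Γ.Adj v (j⁻¹ • w) := by
        rw [← adj_smul j, smul_inv_smul]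
        exact hww'
      obtain ⟨a, ha, ha'⟩ := exists_smul_eq_of_adj hL he ω h1
      obtain ⟨h, hh, c, hc, e1⟩ := hA a⁻¹ (inv_mem (MulAction.mem_stabilizer_iff.2 ha))
      refine ⟨j * (h * t), mul_mem hj (mul_mem hh htN), ?_⟩
      have h2 : c • (e ω : V) = e ω := hc.2
      have h3 : a⁻¹ • (e ω : V) = j⁻¹ • w := by rw [← ha', inv_smul_smul]
      rw [mul_smul, mul_smul, ht, ← h2, ← mul_smul h, ← e1, h3, smul_inv_smul]
  rw [eq_bot_iff]
  intro n hn
  rw [mem_bot]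
  refine Subtype.ext (RelIso.ext fun w => ?_)
  obtain ⟨j, hj, rfl⟩ := key w
  have h1 : j⁻¹ * n * j ∈ N := by
    have := (mem_normalizer_iff.1 (inv_mem hj) n).1 hn
    simpa using this
  have h2 : (j⁻¹ * n * j) • v = v := (hN h1).1
  have h3 : n • j • v = j • v := by
    conv_rhs => rw [← h2]
    simp only [mul_smul, smul_inv_smul]
  exact h3

variable [Finite V] {p : ℕ} [hp : Fact p.Prime]

instance : Finite (Γ ≃g Γ) := Finite.of_injective (fun f : Γ ≃g Γ => (f : V → V)) DFunLike.coe_injective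

/-- The arc-stabiliser maps onto L_ω, and Sylow subgroups lift along surjections. -/
theorem exists_isSylowIn_arcStabilizer (he : (localHom G e).range = L) {ω : Ω}
    (P : Sylow p (MulAction.stabilizer L ω)) :
    ∃ S : Subgroup G, IsSylowIn p S (arcStabilizer Γ G v (e ω)) ∧
      (S.subgroupOf (MulAction.stabilizer G v)).map (localHom G e) =
        (sylowInGroup L ω P).map L.subtype := by
  set B := arcStabilizer Γ G v (e ω)
  have hBA : B ≤ MulAction.stabilizer G v := inf_le_left
  have hmem : ∀ a, localHom G e a ∈ L := fun a => he ▸ ⟨a, rfl⟩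
  have hfix : ∀ a : MulAction.stabilizer G v, (a : G) • (e ω : V) = e ω ↔
      localHom G e a ω = ω := fun a => by
    rw [← localHom_apply, Subtype.coe_inj, e.apply_eq_iff_eq]
  let f : B →* MulAction.stabilizer L ω :=
    (((localHom G e).codRestrict L hmem).comp (inclusion hBA)).codRestrict _
      fun b => (hfix (inclusion hBA b)).1 b.2.2
  have hf : Function.Surjective f := by
    rintro ⟨⟨σ, hσ⟩, hσω⟩
    obtain ⟨a, ha⟩ : σ ∈ (localHom G e).range := he ▸ hσ
    subst ha
    exact ⟨⟨a, a.2, (hfix a).2 hσω⟩, rfl⟩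
  obtain ⟨S, hS⟩ := Sylow.mapSurjective_surjective hf p P
  refine ⟨_, IsSylowIn.of_sylow S, ?_⟩
  rw [← hS]
  ext σ
  constructor
  · rintro ⟨a, ⟨b, hb, hba⟩, rfl⟩
    refine ⟨_, ⟨_, ⟨b, hb, rfl⟩, rfl⟩, ?_⟩
    change localHom G e (inclusion hBA b) = _
    congr 1
    exact Subtype.ext hba
  · rintro ⟨_, ⟨_, ⟨b, hb, rfl⟩, rfl⟩, rfl⟩
    exact ⟨inclusion hBA b, ⟨b, hb, rfl⟩, rfl⟩

/-- Arc-stabilisers of a locally-`L` pair give rise to a pushing amalgam. -/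
theorem IsLocally.exists_isPushingAmalgam (h : IsLocally Γ G L)
    (hL : MulAction.IsPretransitive L Ω) (ω : Ω) (P : Sylow p (MulAction.stabilizer L ω))
    (hP : Nat.card P = p)
    (hl : ∃ l : L, MulAction.IsPretransitive
      (sylowInGroup L ω P ⊔ conjBy (sylowInGroup L ω P) l : Subgroup L) Ω)
    {x y : V} (hxy : Γ.Adj x y) :
    ∃ (S B M : Subgroup G) (l t : G), IsPushingAmalgam p S B M l t ∧
      Nat.card S = p ^ (Nat.card (arcStabilizer Γ G x y)).factorization p := by
  obtain ⟨hΓ, hG, v, e, he⟩ := h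
  replace he := range_localHom e he
  obtain ⟨g, hgx, hgy⟩ := exists_smul_arc_eq hG hL he ω hxy
  obtain ⟨S, hS, hSP⟩ := exists_isSylowIn_arcStabilizer he P
  generalize hf : localHom G e = f at he hSP
  have hfa : ∀ a ω', (e (f a ω') : V) = (a : G) • (e ω' : V) := hf ▸ localHom_apply e
  have hcardB : Nat.card (arcStabilizer Γ G v (e ω)) = Nat.card (arcStabilizer Γ G x y) := by
    rw [← hgy, ← hgx, arcStabilizer_smul, card_conj_smul]
  have hBA : arcStabilizer Γ G v (e ω) ≤ MulAction.stabilizer G v := inf_le_left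
  have hfix : ∀ a : MulAction.stabilizer G v, (a : G) ∈ arcStabilizer Γ G v (e ω) ↔ f a ω = ω := fun a => by
    rw [← e.apply_eq_iff_eq, ← Subtype.coe_inj, hfa]
    exact ⟨fun h => h.2, fun h => ⟨a.2, h⟩⟩
  have htrans : ∀ ω', ∃ a : MulAction.stabilizer G v, f a ω = ω' := fun ω' => by
    obtain ⟨σ, rfl⟩ := hL.exists_smul_eq ω ω'
    obtain ⟨a, ha⟩ : (σ : Equiv.Perm Ω) ∈ f.range := he ▸ σ.2
    exact ⟨a, by rw [ha]; rfl⟩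
  set K : Subgroup G := f.ker.map
    (MulAction.stabilizer G v).subtype with hK
  have hSA : S ≤ MulAction.stabilizer G v := hS.le.trans hBA
  have hSK : K.relIndex S = p := by
    have h1 : K.subgroupOf S = (f.comp (inclusion hSA)).ker := by
      ext s
      rw [mem_subgroupOf, MonoidHom.mem_ker]
      constructor
      · rintro ⟨a, ha, has⟩
        have : a = inclusion hSA s := Subtype.ext has
        rw [MonoidHom.comp_apply, ← this]
        exact ha
      · exact fun hs => ⟨inclusion hSA s, hs, rfl⟩
    have h2 : (f.comp (inclusion hSA)).range = (sylowInGroup L ω P).map L.subtype := by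
      rw [MonoidHom.range_comp, ← hSP, inclusion_range]
    change (K.subgroupOf S).index = p
    rw [h1, index_ker, h2, card_map_of_injective L.subtype_injective, sylowInGroup,
      card_map_of_injective (subtype_injective _)]
    exact hP
  have hKB : K ≤ arcStabilizer Γ G v (e ω) := by
    rintro _ ⟨a, ha, rfl⟩
    refine (hfix a).2 ?_
    rw [(MonoidHom.mem_ker).1 ha]
    rfl
  have hAK : MulAction.stabilizer G v ≤ normalizer (K : Set G) := by
    rw [← normal_subgroupOf_iff_le_normalizer (hKB.trans hBA), hK, subgroupOf,
      comap_map_eq_self_of_injective (subtype_injective _)]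
    infer_instance
  -- Otherwise transitivity reduces Ω to one point and P is trivial.
  have hAB : ¬ MulAction.stabilizer G v ≤ arcStabilizer Γ G v (e ω) := by
    intro hle
    have h1 : ∀ ω', ω' = ω := fun ω' => by
      obtain ⟨a, rfl⟩ := htrans ω'
      exact (hfix a).1 (hle a.2)
    have : Subsingleton Ω := ⟨fun a b => (h1 a).trans (h1 b).symm⟩
    exact hp.out.one_lt.ne' (hP.symm.trans Nat.card_unique)
  obtain ⟨l₀, hl₀⟩ := hl
  -- The inverse appears because P^l is l⁻¹Pl, whereas the amalgam uses lSl⁻¹.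
  obtain ⟨l, hl⟩ : ((l₀⁻¹ : L) : Equiv.Perm Ω) ∈ f.range := he ▸ (l₀⁻¹).2
  -- Arc-transitivity applied to the reversed arc gives an element interchanging its ends.
  obtain ⟨t, htx, hty⟩ := exists_smul_arc_eq hG hL (hf ▸ he) ω (e ω).2.symm
  have hfac : ∀ a ∈ MulAction.stabilizer G v, ∃ h ∈ S ⊔ MulAut.conj (l : G) • S,
      ∃ b ∈ arcStabilizer Γ G v (e ω), a = h * b := by
    intro a ha
    have hSf : ∀ q ∈ sylowInGroup L ω P, ∃ s : MulAction.stabilizer G v, (s : G) ∈ S ∧ f s = q := fun q hq => by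
      have : (q : Equiv.Perm Ω) ∈ (sylowInGroup L ω P).map L.subtype := ⟨q, hq, rfl⟩
      rw [← hSP] at this
      exact this
    have hle : sylowInGroup L ω P ⊔ conjBy (sylowInGroup L ω P) l₀ ≤
        (((S ⊔ MulAut.conj (l : G) • S).subgroupOf (MulAction.stabilizer G v)).map f).subgroupOf L := by
      refine sup_le (fun q hq => ?_) ?_
      · obtain ⟨s, hs, hsq⟩ := hSf q hq
        exact ⟨s, mem_subgroupOf.2 (mem_sup_left hs), hsq⟩
      · rintro _ ⟨q, hq, rfl⟩
        obtain ⟨s, hs, hsq⟩ := hSf q hq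
        refine ⟨l * s * l⁻¹, mem_subgroupOf.2 (mem_sup_right (conj_mem_conj_smul hs)), ?_⟩
        rw [map_mul, map_mul, map_inv, hsq, hl]
        rfl
    obtain ⟨q, hq⟩ := hl₀.exists_smul_eq ω (f ⟨a, ha⟩ ω)
    obtain ⟨h, hh, hhq⟩ := hle q.2
    have hω : f h ω = f ⟨a, ha⟩ ω := by rw [hhq, ← hq]; rfl
    refine ⟨h, hh, h⁻¹ * a, (hfix (h⁻¹ * ⟨a, ha⟩)).2 ?_, (mul_inv_cancel_left _ _).symm⟩
    rw [map_mul, Equiv.Perm.mul_apply, ← hω, map_inv, Equiv.Perm.inv_eq_iff_eq]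
  have htB : MulAut.conj t • arcStabilizer Γ G v (e ω) = arcStabilizer Γ G v (e ω) := by
    rw [← arcStabilizer_smul, htx, hty, arcStabilizer_comm]
  have ht2 : t * t ∈ arcStabilizer Γ G v (e ω) :=
    ⟨(mul_smul t t v).trans (by rw [hty, htx]),
      (mul_smul t t (e ω : V)).trans (by rw [htx, hty])⟩
  obtain ⟨B', M, l', t', ham⟩ := _root_.exists_isPushingAmalgam hBA hKB hAK hAB hS hSK l.2 hfac
    htB ht2 fun N hN b hb hfac hbt =>
      eq_bot_of_le_arcStabilizer hΓ hL (hf ▸ he) hN hfac (t := b * t)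
        (by rw [mul_smul, hty]; exact hb.2) hbt
  refine ⟨S, B', M, l', t', ham, ?_⟩
  rw [← hcardB]
  exact hS.card_eq

end Arc

end LocalAction

theorem corollary2p4 {Ω : Type u} (p : ℕ) (hp : p.Prime) (L : Subgroup (Equiv.Perm Ω))
    (hL : MulAction.IsPretransitive L Ω) (x : Ω) (P : Sylow p (MulAction.stabilizer L x))
    (hP : Nat.card P = p)
    (hl : ∃ l : L, MulAction.IsPretransitive
      (LocalAction.sylowInGroup L x P ⊔
        LocalAction.conjBy (LocalAction.sylowInGroup L x P) l : Subgroup L) Ω) :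
    LocalAction.IsPGraphRestrictive.{u, v} p L ∧
      (Odd p → LocalAction.PGraphRestrictiveBound.{u, v} p L (p ^ 6)) ∧
      (p = 2 → LocalAction.PGraphRestrictiveBound.{u, v} p L 16) := by
  have : Fact p.Prime := ⟨hp⟩
  have h6 : LocalAction.PGraphRestrictiveBound.{u, v} p L (p ^ 6) := by
    intro V _ Γ G hΓ y z hyz
    obtain ⟨S, B, M, l, t, h, hS⟩ := hΓ.exists_isPushingAmalgam hL x P hP hl hyz
    rw [← hS]
    exact h.card_le_pow_six
  refine ⟨⟨hL, p ^ 6, h6⟩, fun _ => h6, ?_⟩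
  rintro rfl V _ Γ G hΓ y z hyz
  obtain ⟨S, B, M, l, t, h, hS⟩ := hΓ.exists_isPushingAmalgam hL x P hP hl hyz
  rw [← hS]
  exact h.card_le_sixteen
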